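/- For a group $G$ with $[G,G]\le Z(G)$ write $\circ_G\colon G/Z(G)\times G/Z(G)\to [G,G]$, $(xZ(G),yZ(G))\mapsto [x,y]$, for its commutation map, which is biadditive. Its centroid $C(\circ_G)$ is the ring of all triples $(\sigma_1,\sigma_2,\sigma_3)$ of endomorphisms $\sigma_1,\sigma_2\in\mathrm{End}(G/Z(G))$, $\sigma_3\in\mathrm{End}([G,G])$ such that $(u\sigma_1)\circ_G v=(u\circ_G v)\sigma_3=u\circ_G(v\sigma_2)$ for all $u,v\in G/Z(G)$. Say that $G$ has genus $2$ over a field if $[G,G]\le Z(G)$, the ring $k=C(\circ_G)$ is a field, and $[G,G]$ has dimension $2$ as a vector space over $k$. Two groups $G,H$ are isoclinic if there are isomorphisms $f\colon G/Z(G)\to H/Z(H)$ and $\hat f\colon [G,G]\to[H,H]$ with $(uf)\circ_H(vf)=(u\circ_G v)\hat f$ for all $u,v\in G/Z(G)$. There are absolute constants $a,b\in\mathbb{R}$ such that for every prime $p$ and every integer $n\ge 5$, the number $N(p,n)$ of isoclinism classes of groups of order $p^n$ that have genus $2$ over a field (equivalently, the largest number of pairwise non-isoclinic such groups) satisfies $$p^{\,n/2+a}\;\le\;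 N(p,n)\;\le\; p^{\,n/2+b}.$$ That is, $N(p,n)=p^{\,n/2+\Theta(1)}$, where $\Theta(1)$ stands for a quantity that is bounded above and below. (For $n\le 4$ there are no such groups.) -/

import Mathlib

section

open Subgroup
open scoped commutatorElement

/-! ### The commutation map and isoclinism -/

/-- `[x z, y w] = [x, y]` for central `z`, `w`. -/
theorem commutatorElement_eq_of_mk_eq {G : Type*} [Group G] {x x' y y' : G}
    (hx : (x : G ⧸ center G) = x') (hy : (y : G ⧸ center G) = y') : ⁅x, y⁆ = ⁅x', y'⁆ := by
  obtain ⟨z, hz, rfl⟩ : ∃ z ∈ center G, x * z = x' :=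
    ⟨x⁻¹ * x', QuotientGroup.eq.mp hx, by group⟩
  obtain ⟨w, hw, rfl⟩ : ∃ w ∈ center G, y * w = y' :=
    ⟨y⁻¹ * y', QuotientGroup.eq.mp hy, by group⟩
  rw [mem_center_iff] at hz hw
  have h1 : (x * z) * (y * w) = (x * y) * (z * w) := by
    rw [mul_assoc, ← mul_assoc z, ← hz y]; group
  have h2 : (y * w) * (x * z) = (y * x) * (z * w) := by
    rw [mul_assoc, ← mul_assoc w, ← hw x, mul_assoc x, ← hw z]; group
  have h3 (a b : G) : ⁅a, b⁆ = (a * b) * (b * a)⁻¹ := by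
    rw [commutatorElement_def]; group
  rw [h3, h3, h1, h2]; group

/-- The commutation map `G/Z(G) × G/Z(G) → G'`, `(xZ(G), yZ(G)) ↦ [x, y]`. -/
def commutationMap (G : Type*) [Group G] (a b : G ⧸ center G) : commutator G :=
  Quotient.liftOn₂' a b
    (fun x y => ⟨⁅x, y⁆, commutator_mem_commutator (mem_top x) (mem_top y)⟩)
    (fun _ _ _ _ h₁ h₂ => Subtype.ext
      (commutatorElement_eq_of_mk_eq (Quotient.sound' h₁) (Quotient.sound' h₂)))

theorem commutationMap_mk {G : Type*} [Group G] (x y : G) :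
    (commutationMap G (x : G ⧸ center G) (y : G ⧸ center G) : G) = ⁅x, y⁆ := rfl

/-- Two groups are isoclinic if there are isomorphisms `G/Z(G) ≃ H/Z(H)` and `G' ≃ H'` that
carry the commutation map of `G` to that of `H`. -/
def Isoclinic (G H : Type*) [Group G] [Group H] : Prop :=
  ∃ (f : G ⧸ center G ≃* H ⧸ center H) (g : commutator G ≃* commutator H),
    ∀ a b : G ⧸ center G, commutationMap H (f a) (f b) = g (commutationMap G a b)

theorem Isoclinic.refl (G : Type*) [Group G] : Isoclinic G G :=
  ⟨MulEquiv.refl _, MulEquiv.refl _, fun _ _ => rfl⟩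

theorem Isoclinic.symm {G H : Type*} [Group G] [Group H] (h : Isoclinic G H) :
    Isoclinic H G := by
  obtain ⟨f, g, hfg⟩ := h
  refine ⟨f.symm, g.symm, fun a b => ?_⟩
  rw [MulEquiv.eq_symm_apply, ← hfg, MulEquiv.apply_symm_apply, MulEquiv.apply_symm_apply]

theorem Isoclinic.trans {G H K : Type*} [Group G] [Group H] [Group K]
    (h₁ : Isoclinic G H) (h₂ : Isoclinic H K) : Isoclinic G K := by
  obtain ⟨f, g, hfg⟩ := h₁
  obtain ⟨f', g', hfg'⟩ := h₂
  refine ⟨f.trans f', g.trans g', fun a b => ?_⟩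
  simp only [MulEquiv.trans_apply, hfg', hfg]

/-! ### The centroid of a biadditive map -/

/-- The centroid of a biadditive map `B : U × V → W`: the ring of all triples
`σ = (σ_U, σ_V, σ_W)` of additive endomorphisms with
`B (σ_U u) v = σ_W (B u v) = B u (σ_V v)` for all `u`, `v`. -/
def centroid {U V W : Type*} [AddCommGroup U] [AddCommGroup V] [AddCommGroup W]
    (B : U →+ V →+ W) :
    Subring (AddMonoid.End U × AddMonoid.End V × AddMonoid.End W) where
  carrier := {σ | ∀ u v, B (σ.1 u) v = σ.2.2 (B u v) ∧ B u (σ.2.1 v) = σ.2.2 (B u v)}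
  mul_mem' := fun {σ τ} hσ hτ u v => by
    refine ⟨?_, ?_⟩
    · change B (σ.1 (τ.1 u)) v = σ.2.2 (τ.2.2 (B u v))
      rw [(hσ _ _).1, (hτ _ _).1]
    · change B u (σ.2.1 (τ.2.1 v)) = σ.2.2 (τ.2.2 (B u v))
      rw [(hσ _ _).2, (hτ _ _).2]
  one_mem' := fun _ _ => ⟨rfl, rfl⟩
  add_mem' := fun {σ τ} hσ hτ u v => by
    refine ⟨?_, ?_⟩
    · change B (σ.1 u + τ.1 u) v = σ.2.2 (B u v) + τ.2.2 (B u v)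
      rw [map_add, AddMonoidHom.add_apply, (hσ _ _).1, (hτ _ _).1]
    · change B u (σ.2.1 v + τ.2.1 v) = σ.2.2 (B u v) + τ.2.2 (B u v)
      rw [map_add, (hσ _ _).2, (hτ _ _).2]
  zero_mem' := fun u v => by
    refine ⟨?_, ?_⟩
    · change B 0 v = 0
      rw [map_zero, AddMonoidHom.zero_apply]
    · change B u 0 = 0
      rw [map_zero]
  neg_mem' := fun {σ} hσ u v => by
    refine ⟨?_, ?_⟩
    · change B (-(σ.1 u)) v = -(σ.2.2 (B u v))
      rw [map_neg, AddMonoidHom.neg_apply, (hσ _ _).1]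
    · change B u (-(σ.2.1 v)) = -(σ.2.2 (B u v))
      rw [map_neg, (hσ _ _).2]

/-- The centroid acts on `W` through its third component: `σ • w = σ_W w`. -/
instance centroid.moduleCodomain {U V W : Type*} [AddCommGroup U] [AddCommGroup V]
    [AddCommGroup W] (B : U →+ V →+ W) : Module (centroid B) W :=
  Module.compHom W
    (((RingHom.snd (AddMonoid.End V) (AddMonoid.End W)).comp
      (RingHom.snd (AddMonoid.End U) (AddMonoid.End V × AddMonoid.End W))).comp
        (centroid B).subtype)

theorem centroid.smul_def {U V W : Type*} [AddCommGroup U] [AddCommGroup V]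
    [AddCommGroup W] (B : U →+ V →+ W) (σ : centroid B) (w : W) : σ • w = σ.1.2.2 w := rfl

/-! ### The commutation bimap of a nilpotent group of class at most two -/

/-- `G` is nilpotent of class at most two: `G' ≤ Z(G)`. -/
class IsClassTwo (G : Type*) [Group G] : Prop where
  commutator_le_center : commutator G ≤ center G

/-- If `G' ≤ Z(G)` then `G'` is abelian. -/
instance IsClassTwo.commGroupCommutator (G : Type*) [Group G] [IsClassTwo G] :
    CommGroup (commutator G) :=
  { (inferInstance : Group (commutator G)) with
    mul_comm := fun a b => Subtype.ext
      (mem_center_iff.mp (IsClassTwo.commutator_le_center b.2) a.1) }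

/-- If `G' ≤ Z(G)` then `G/Z(G)` is abelian. -/
instance IsClassTwo.commGroupQuotientCenter (G : Type*) [Group G] [IsClassTwo G] :
    CommGroup (G ⧸ center G) :=
  { (inferInstance : Group (G ⧸ center G)) with
    mul_comm := by
      rintro ⟨x⟩ ⟨y⟩
      refine QuotientGroup.eq.mpr (IsClassTwo.commutator_le_center ?_)
      have h : (x * y)⁻¹ * (y * x) = ⁅y⁻¹, x⁻¹⁆ := by
        rw [commutatorElement_def]; group
      rw [h]
      exact commutator_mem_commutator (mem_top _) (mem_top _) }

theorem commutationMap_mul_left {G : Type*} [Group G] [IsClassTwo G] (a a' b : G ⧸ center G) :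
    commutationMap G (a * a') b = commutationMap G a b * commutationMap G a' b := by
  induction a using QuotientGroup.induction_on with | _ x
  induction a' using QuotientGroup.induction_on with | _ x'
  induction b using QuotientGroup.induction_on with | _ y
  apply Subtype.ext
  change ⁅x * x', y⁆ = ⁅x, y⁆ * ⁅x', y⁆
  have h := mem_center_iff.mp (IsClassTwo.commutator_le_center
    (commutator_mem_commutator (mem_top x') (mem_top y)) : ⁅x', y⁆ ∈ center G)
  have h1 : ⁅x * x', y⁆ = x * ⁅x', y⁆ * (y * x⁻¹ * y⁻¹) := by
    simp only [commutatorElement_def]; group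
  rw [h1, h x, mul_assoc, ← h]
  congr 1
  rw [commutatorElement_def]; group

theorem commutationMap_mul_right {G : Type*} [Group G] [IsClassTwo G] (a b b' : G ⧸ center G) :
    commutationMap G a (b * b') = commutationMap G a b * commutationMap G a b' := by
  have hswap (c d : G ⧸ center G) : commutationMap G c d = (commutationMap G d c)⁻¹ := by
    induction c using QuotientGroup.induction_on with | _ x
    induction d using QuotientGroup.induction_on with | _ y
    apply Subtype.ext
    change ⁅x, y⁆ = ⁅y, x⁆⁻¹
    rw [commutatorElement_inv]
  rw [hswap, commutationMap_mul_left, mul_inv, ← hswap, ← hswap]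

/-- The commutation map of a group of class at most two as a biadditive map
`G/Z(G) × G/Z(G) → G'`, all groups written additively. -/
def commutationBimap (G : Type*) [Group G] [IsClassTwo G] :
    Additive (G ⧸ center G) →+ Additive (G ⧸ center G) →+ Additive (commutator G) :=
  AddMonoidHom.mk'
    (fun a => AddMonoidHom.mk'
      (fun b => Additive.ofMul (commutationMap G a.toMul b.toMul))
      (fun _ _ => congrArg Additive.ofMul (commutationMap_mul_right _ _ _)))
    (fun _ _ => AddMonoidHom.ext fun _ =>
      congrArg Additive.ofMul (commutationMap_mul_left _ _ _))

/-! ### Groups of genus two over a field, and their number up to isoclinism -/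

/-- `G` has genus `g` over a field: `G` is nilpotent of class at most two, the centroid `C` of
its commutation bimap is a field, and `G'` has dimension `g` over `C`.
(As a field is not a product of two nontrivial rings, such a group is not isoclinic to a product
of two nonabelian groups, so there is only one factor to take the rank of. For `g ≥ 1` the group
is not abelian, so its class is exactly two.) -/
def HasGenusOverField (G : Type*) [Group G] (g : ℕ) : Prop :=
  ∃ _ : IsClassTwo G, IsField (centroid (commutationBimap G)) ∧
    Module.finrank (centroid (commutationBimap G)) (Additive (commutator G)) = g

/-- The group structures of genus two over a field on a fixed set with `N` elements. Every group
of order `N` that has genus two over a field is isomorphic to one of them. -/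
def GenusTwoGroup (N : ℕ) : Type :=
  {G : Group (Fin N) // @HasGenusOverField (Fin N) G 2}

/-- Isoclinism as an equivalence relation on the groups of order `N` that have genus two over
a field. -/
def isoclinismSetoid (N : ℕ) : Setoid (GenusTwoGroup N) where
  r G H := @Isoclinic (Fin N) (Fin N) G.1 H.1
  iseqv :=
    { refl := fun G => @Isoclinic.refl (Fin N) G.1
      symm := fun {G H} h => @Isoclinic.symm (Fin N) (Fin N) G.1 H.1 h
      trans := fun {G H K} h₁ h₂ =>
        @Isoclinic.trans (Fin N) (Fin N) (Fin N) G.1 H.1 K.1 h₁ h₂ }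

/-- The number of isoclinism classes of groups of order `N` that have genus two over a field, that
is, the largest number of pairwise non-isoclinic such groups. -/
noncomputable def numGenusTwo (N : ℕ) : ℕ :=
  Nat.card (Quotient (isoclinismSetoid N))

end

open Module Polynomial


/-! ### Pairs of alternating forms -/

/-! Let `G` have order p^n and genus two over a field with q = p^e elements. Its commutation map is
a pair of alternating forms `A`, `B` on a space `V` of dimension d over that field. Since |G/Z(G)| =
q^d, |G'| = q^2 and G' ≤ Z(G), one has e(d + 2) ≤ n. Isometric pairs belong to isoclinic groups.

Upper bound. It suffices that at most K q^(d/2) isometry classes of pairs exist in dimension d, with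
K absolute (`AltPair.exists_ncard_le`): the sum of p^(ed/2) over e(d + 2) ≤ n is dominated by
geometric series and is O(p^(n/2)). If `A` is nondegenerate, then B(x, y) = A(Tx, y) with `T`
self-adjoint, and `V` is an orthogonal sum of blocks (k[X]/f_i)^2 with f_(i+1) dividing f_i
(`exists_block`, `exists_hasChain`). The successive quotients g_i of the f_i determine the pair and
satisfy Σ (i + 1) deg g_i ≤ d/2; an Euler product bounds their number by 8 q^(d/2). If `A` has
corank r, split off a part of its radical on which `B` is nondegenerate, then the common radical. By
Witt's theorem, what remains is determined by its dimension, its corank and a core from which twice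
the corank has gone (`Reduced.iso_of_core_iso`). In the resulting induction the corank r costs a
factor 1 + O(r^2 (3/4)^r), and the product of these factors converges.

Lower bound. For `f` monic of degree m over F_p let R = F_p[X]/f, let θ be the class of X, and let φ
be a functional on `R` that vanishes on no nonzero ideal. With ω(u, v) = u₁v₂ - v₁u₂, the pencil
(φ(ω), φ(θω)) on R^2 has only scalars in its centroid when m ≥ 3, and a central extension of order
p^n realises it when 2m + 2 ≤ n. An isoclinism between two such groups makes one root a fractional
linear transform of the other, and the 2 × 2 matrix over F_p of this transformation determines the
second polynomial. So at most p^4 of the p^m polynomials share a class; take m = ⌊(n - 2)/2⌋. -/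

/-- A finite dimensional vector space with two alternating bilinear forms. -/
structure AltPair (k : Type) [Field k] where
  V : Type
  [addCommGroup : AddCommGroup V]
  [module : Module k V]
  [finiteDimensional : FiniteDimensional k V]
  A : LinearMap.BilinForm k V
  B : LinearMap.BilinForm k V
  altA : A.IsAlt
  altB : B.IsAlt

attribute [instance] AltPair.addCommGroup AltPair.module AltPair.finiteDimensional

namespace AltPair

variable {k : Type} [Field k]

/-- Isometry of pairs of alternating forms. -/
def Iso (P Q : AltPair k) : Prop :=
  ∃ φ : P.V ≃ₗ[k] Q.V, (∀ x y, Q.A (φ x) (φ y) = P.A x y) ∧ ∀ x y, Q.B (φ x) (φ y) = P.B x y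

theorem Iso.refl (P : AltPair k) : P.Iso P := ⟨LinearEquiv.refl _ _, fun _ _ => rfl, fun _ _ => rfl⟩

theorem Iso.symm {P Q : AltPair k} (h : P.Iso Q) : Q.Iso P := by
  obtain ⟨φ, hA, hB⟩ := h
  exact ⟨φ.symm, fun x y => by rw [← hA]; simp, fun x y => by rw [← hB]; simp⟩

theorem Iso.trans {P Q R : AltPair k} (h : P.Iso Q) (h' : Q.Iso R) : P.Iso R := by
  obtain ⟨φ, hA, hB⟩ := h
  obtain ⟨ψ, hA', hB'⟩ := h'
  exact ⟨φ.trans ψ, fun x y => by simp [hA, hA'], fun x y => by simp [hB, hB']⟩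

instance setoid (k : Type) [Field k] : Setoid (AltPair k) :=
  ⟨Iso, Iso.refl, Iso.symm, Iso.trans⟩

/-- Restriction of a pair of forms to a subspace. -/
def sub (P : AltPair k) (S : Submodule k P.V) : AltPair k where
  V := S
  A := P.A.domRestrict₁₂ S S
  B := P.B.domRestrict₁₂ S S
  altA x := P.altA x
  altB x := P.altB x

@[simp] theorem sub_A (P : AltPair k) (S : Submodule k P.V) (x y : S) :
    (P.sub S).A x y = P.A x y := rfl

@[simp] theorem sub_B (P : AltPair k) (S : Submodule k P.V) (x y : S) :
    (P.sub S).B x y = P.B x y := rfl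

/-- Two pairs are isometric if they have isometric orthogonal decompositions. -/
theorem iso_of_isCompl {P Q : AltPair k} {S T : Submodule k P.V} {S' T' : Submodule k Q.V}
    (h : IsCompl S T) (h' : IsCompl S' T')
    (hA : ∀ x ∈ S, ∀ y ∈ T, P.A x y = 0) (hB : ∀ x ∈ S, ∀ y ∈ T, P.B x y = 0)
    (hA' : ∀ x ∈ S', ∀ y ∈ T', Q.A x y = 0) (hB' : ∀ x ∈ S', ∀ y ∈ T', Q.B x y = 0)
    (hS : (P.sub S).Iso (Q.sub S')) (hT : (P.sub T).Iso (Q.sub T')) : P.Iso Q := by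
  obtain ⟨φ, φA, φB⟩ := hS
  obtain ⟨ψ, ψA, ψB⟩ := hT
  let e := Submodule.prodEquivOfIsCompl S T h
  let e' := Submodule.prodEquivOfIsCompl S' T' h'
  let φ₁ : S ≃ₗ[k] S' := φ
  let ψ₁ : T ≃ₗ[k] T' := ψ
  let Φ : P.V ≃ₗ[k] Q.V := (e.symm.trans (LinearEquiv.prodCongr φ₁ ψ₁)).trans e'
  have key : ∀ (s : S) (t : T), Φ ((s : P.V) + t) = (φ₁ s : Q.V) + (ψ₁ t : Q.V) := by
    intro s t
    have : (s : P.V) + t = e (s, t) := rfl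
    rw [this]
    simp only [Φ, LinearEquiv.trans_apply, LinearEquiv.symm_apply_apply]
    rfl
  have rep : ∀ x : P.V, ∃ (s : S) (t : T), x = (s : P.V) + t := fun x =>
    ⟨(e.symm x).1, (e.symm x).2, (e.apply_symm_apply x).symm⟩
  refine ⟨Φ, fun x y => ?_, fun x y => ?_⟩
  · obtain ⟨s, t, rfl⟩ := rep x
    obtain ⟨s', t', rfl⟩ := rep y
    rw [key, key]
    simp only [map_add, LinearMap.add_apply]
    rw [hA _ s.2 _ t'.2, hA' _ (φ₁ s).2 _ (ψ₁ t').2, ← P.altA.neg_eq (s' : P.V) t, ← Q.altA.neg_eq (φ₁ s' : Q.V) (ψ₁ t),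
      hA _ s'.2 _ t.2, hA' _ (φ₁ s').2 _ (ψ₁ t).2]
    congr 2
    · exact φA s s'
    · exact ψA t t'
  · obtain ⟨s, t, rfl⟩ := rep x
    obtain ⟨s', t', rfl⟩ := rep y
    rw [key, key]
    simp only [map_add, LinearMap.add_apply]
    rw [hB _ s.2 _ t'.2, hB' _ (φ₁ s).2 _ (ψ₁ t').2, ← P.altB.neg_eq (s' : P.V) t, ← Q.altB.neg_eq (φ₁ s' : Q.V) (ψ₁ t),
      hB _ s'.2 _ t.2, hB' _ (φ₁ s').2 _ (ψ₁ t).2]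
    congr 2
    · exact φB s s'
    · exact ψB t t'

end AltPair

/-! ### Witt's extension theorem for symplectic spaces -/

section Witt

variable {k V W : Type*} [Field k] [AddCommGroup V] [Module k V] [FiniteDimensional k V]
  [AddCommGroup W] [Module k W] [FiniteDimensional k W]
  {A : LinearMap.BilinForm k V} {A' : LinearMap.BilinForm k W}

/-- One step of Witt's theorem: the image of one more vector. -/
theorem exists_witt_vector (hA : A.IsAlt) (hA' : A'.IsAlt) (hn : A.Nondegenerate)
    (hn' : A'.Nondegenerate) (hd : finrank k V = finrank k W) (X : Submodule k V)
    (φ : V →ₗ[k] W) (hinj : ∀ x ∈ X, φ x = 0 → x = 0)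
    (hiso : ∀ x ∈ X, ∀ y ∈ X, A' (φ x) (φ y) = A x y) (z : V) (hz : z ∉ X) :
    ∃ w : W, w ∉ X.map φ ∧ ∀ x ∈ X, A' w (φ x) = A z x := by
  have hinj' : LinearMap.ker (φ.domRestrict X) = ⊥ := by
    rw [eq_bot_iff]
    intro x hx
    rw [Submodule.mem_bot]
    exact Subtype.ext (hinj x x.2 hx)
  obtain ⟨g, hg⟩ := LinearMap.exists_leftInverse_of_injective _ hinj'
  have hg' : ∀ x (hx : x ∈ X), g (φ x) = ⟨x, hx⟩ := fun x hx => LinearMap.congr_fun hg ⟨x, hx⟩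
  -- Nondegeneracy of `A'` represents the functional `A z`, carried over by `φ`; only `w₀ ∉ X.map φ`
  -- can fail.
  let w₀ : W := (LinearMap.BilinForm.toDual A' hn').symm ((A z) ∘ₗ X.subtype ∘ₗ g)
  have hw₀ : ∀ x ∈ X, A' w₀ (φ x) = A z x := by
    intro x hx
    simp only [w₀, LinearMap.BilinForm.apply_toDual_symm_apply, LinearMap.comp_apply, hg' x hx]
    rfl
  by_cases hw : w₀ ∈ X.map φ
  swap
  · exact ⟨w₀, hw, hw₀⟩
  -- `w₀` may be moved by any vector orthogonal to the image. If all such vectors lie in the image,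
  -- a dimension count puts the orthogonal space of `X` inside `X`, which forces `z ∈ X`.
  by_cases hle : A'.orthogonal (X.map φ) ≤ X.map φ
  swap
  · obtain ⟨u, hu, hu'⟩ := SetLike.not_le_iff_exists.mp hle
    refine ⟨w₀ + u, fun h => hu' (by simpa using Submodule.sub_mem _ h hw), fun x hx => ?_⟩
    have : A' u (φ x) = 0 := by
      rw [← hA'.neg_eq, neg_eq_zero]
      exact hu _ (Submodule.mem_map_of_mem hx)
    rw [map_add, LinearMap.add_apply, hw₀ x hx, this, add_zero]
  exfalso
  obtain ⟨x₀, hx₀, hxw⟩ := hw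
  let S : Submodule k V := X ⊓ (A'.orthogonal (X.map φ)).comap φ
  have hmap : S.map φ = A'.orthogonal (X.map φ) := by
    apply le_antisymm
    · rintro _ ⟨x, hx, rfl⟩
      exact hx.2
    · intro u hu
      obtain ⟨x, hx, rfl⟩ := hle hu
      exact ⟨x, ⟨hx, hu⟩, rfl⟩
  have hSle : S ≤ A.orthogonal X := by
    intro x hx y hy
    change A y _ = 0
    rw [← hiso y hy x hx.1]
    exact hx.2 _ (Submodule.mem_map_of_mem hy)
  have hXd : finrank k (X.map φ) = finrank k X := by
    have := LinearMap.finrank_range_of_inj (LinearMap.ker_eq_bot.mp hinj')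
    rwa [LinearMap.range_domRestrict] at this
  have hdim : finrank k (A.orthogonal X) ≤ finrank k S := by
    rw [LinearMap.BilinForm.finrank_orthogonal hn, hd, ← hXd,
      ← LinearMap.BilinForm.finrank_orthogonal hn', ← hmap]
    exact Submodule.finrank_map_le φ S
  have heq := Submodule.eq_of_le_of_finrank_le hSle hdim
  have hzx : z - x₀ ∈ A.orthogonal X := by
    intro y hy
    change A y _ = 0
    rw [← hA.neg_eq, neg_eq_zero, map_sub, LinearMap.sub_apply,
      ← hw₀ y hy, ← hxw, hiso _ hx₀ _ hy, sub_self]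
  rw [← heq] at hzx
  exact hz (by simpa using X.add_mem hzx.1 hx₀)

/-- Witt's theorem: an isometry from a subspace of a symplectic space to a symplectic space of the
same dimension extends. -/
theorem exists_witt_extension (hA : A.IsAlt) (hA' : A'.IsAlt) (hn : A.Nondegenerate)
    (hn' : A'.Nondegenerate) (hd : finrank k V = finrank k W) (X : Submodule k V)
    (φ : V →ₗ[k] W) (hinj : ∀ x ∈ X, φ x = 0 → x = 0)
    (hiso : ∀ x ∈ X, ∀ y ∈ X, A' (φ x) (φ y) = A x y) :
    ∃ Φ : V ≃ₗ[k] W, (∀ x y, A' (Φ x) (Φ y) = A x y) ∧ ∀ x ∈ X, Φ x = φ x := by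
  induction hc : finrank k V - finrank k X using Nat.strong_induction_on generalizing X φ with
  | _ c ih =>
  by_cases hX : X = ⊤
  · subst hX
    have hi : Function.Injective φ := by
      rw [injective_iff_map_eq_zero]
      exact fun x => hinj x trivial
    exact ⟨LinearEquiv.ofInjectiveOfFinrankEq φ hi hd, fun x y => hiso x trivial y trivial,
      fun x _ => rfl⟩
  obtain ⟨z, -, hz⟩ := SetLike.exists_of_lt (lt_top_iff_ne_top.mpr hX)
  obtain ⟨w, hw, hwX⟩ := exists_witt_vector hA hA' hn hn' hd X φ hinj hiso z hz
  obtain ⟨l, hl0, hl⟩ := Submodule.exists_le_ker_of_notMem hz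
  -- `l` vanishes on `X` but not at `z`, so `ψ` extends `φ` and sends `z` to `w`. Every vector is
  -- isotropic, so `w` has no norm condition to meet.
  let ψ : V →ₗ[k] W := φ + ((l z)⁻¹ • l).smulRight (w - φ z)
  have hψX : ∀ x ∈ X, ψ x = φ x := fun x hx => by
    have : l x = 0 := hl hx
    simp [ψ, this]
  have hψz : ψ z = w := by
    simp [ψ, hl0]
  have hlt : X < X ⊔ k ∙ z := by
    refine lt_of_le_of_ne le_sup_left fun h => hz ?_
    rw [h]
    exact Submodule.mem_sup_right (Submodule.mem_span_singleton_self z)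
  have hfr := Submodule.finrank_lt_finrank_of_lt hlt
  have hfr' := Submodule.finrank_le (X ⊔ k ∙ z)
  obtain ⟨Φ, hΦ, hΦX⟩ := ih _ (by omega) (X ⊔ k ∙ z) ψ (by
    intro v hv hv0
    obtain ⟨x, hx, y, hy, rfl⟩ := Submodule.mem_sup.mp hv
    obtain ⟨a, rfl⟩ := Submodule.mem_span_singleton.mp hy
    rw [map_add, map_smul, hψX x hx, hψz] at hv0
    by_cases ha : a = 0
    · subst ha
      simp only [zero_smul, add_zero] at hv0 ⊢
      exact hinj x hx hv0
    · exfalso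
      apply hw
      refine ⟨-(a⁻¹ • x), X.neg_mem (X.smul_mem _ hx), ?_⟩
      rw [map_neg, map_smul, eq_neg_of_add_eq_zero_left hv0]
      simp [smul_smul, ha]) (by
    intro v hv v' hv'
    obtain ⟨x, hx, y, hy, rfl⟩ := Submodule.mem_sup.mp hv
    obtain ⟨a, rfl⟩ := Submodule.mem_span_singleton.mp hy
    obtain ⟨x', hx', y', hy', rfl⟩ := Submodule.mem_sup.mp hv'
    obtain ⟨a', rfl⟩ := Submodule.mem_span_singleton.mp hy'
    simp only [map_add, map_smul, LinearMap.add_apply, LinearMap.smul_apply, hψX x hx, hψX x' hx',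
      hψz, hiso x hx x' hx', hwX x' hx']
    rw [← hA'.neg_eq w, hwX x hx, hA.neg_eq, hA.self_eq_zero, hA'.self_eq_zero]) rfl
  exact ⟨Φ, hΦ, fun x hx => by rw [hΦX x (Submodule.mem_sup_left hx), hψX x hx]⟩

end Witt


/-! ### Reduction of a pair along the radical of its first form -/

section Halving

variable {k V : Type*} [Field k] [AddCommGroup V] [Module k V] [FiniteDimensional k V]

/-- An alternating form is the difference of a bilinear form and its transpose. -/
theorem LinearMap.BilinForm.IsAlt.exists_sub_flip {E : LinearMap.BilinForm k V} (hE : E.IsAlt) :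
    ∃ b : LinearMap.BilinForm k V, ∀ x y, b x y - b y x = E x y := by
  let e := finBasis k V
  -- The strictly upper triangular half of the Gram matrix needs no division by two.
  let b : LinearMap.BilinForm k V :=
    Matrix.toBilin e (Matrix.of fun i j => if i < j then E (e i) (e j) else 0)
  have hb : ∀ i j, b (e i) (e j) = if i < j then E (e i) (e j) else 0 := fun i j => by
    have := congrFun (congrFun (LinearMap.BilinForm.toMatrix_toBilin e
      (Matrix.of fun i j => if i < j then E (e i) (e j) else 0)) i) j
    rwa [LinearMap.BilinForm.toMatrix_apply] at this
  have : b - b.flip = E := by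
    refine LinearMap.BilinForm.ext_basis e fun i j => ?_
    change b (e i) (e j) - b (e j) (e i) = _
    rw [hb, hb]
    rcases lt_trichotomy i j with h | h | h
    · simp [h, h.asymm]
    · subst h; simp [hE.self_eq_zero]
    · simp [h, h.asymm, hE.neg_eq]
  exact ⟨b, fun x y => by rw [← this]; rfl⟩

/-- If an alternating form vanishes on `X`, it is the difference of a bilinear form with `X` in its
right kernel and its transpose. -/
theorem LinearMap.BilinForm.IsAlt.exists_sub_flip_of_isotropic {E : LinearMap.BilinForm k V}
    (hE : E.IsAlt) (X : Submodule k V) (hX : ∀ x ∈ X, ∀ y ∈ X, E x y = 0) :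
    ∃ b : LinearMap.BilinForm k V, (∀ x y, b x y - b y x = E x y) ∧ ∀ z, ∀ x ∈ X, b z x = 0 := by
  obtain ⟨Y, hY⟩ := Submodule.exists_isCompl X
  obtain ⟨h, hh⟩ := hE.exists_sub_flip
  let p := X.projection Y hY
  let q := Y.projection X hY.symm
  have hpq : ∀ x, x = p x + q x := fun x => (Submodule.projection_add_projection_eq_self hY x).symm
  -- `E` is zero on `X`, so only the mixed terms and the part on `Y` remain. The first summand
  -- yields the former, the second the latter, and both have `q`, which kills `X`, on the right.
  refine ⟨E.compl₁₂ p q + h.compl₁₂ q q, fun x y => ?_, fun z x hx => ?_⟩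
  · conv_rhs => rw [hpq x, hpq y]
    simp only [LinearMap.add_apply, LinearMap.compl₁₂_apply, map_add]
    rw [hX _ (Submodule.projection_apply_mem hY x) _ (Submodule.projection_apply_mem hY y),
      ← hE.neg_eq (p y) (q x), ← hh (q x) (q y)]
    ring
  · have : q x = 0 := (Submodule.projection_apply_eq_zero_iff hY.symm).mpr hx
    simp [this]

end Halving

namespace AltPair

variable {k : Type} [Field k]

/-- The second form vanishes on the radical of the first. -/
def IsotropicRad (P : AltPair k) : Prop :=
  ∀ x y, P.A x = 0 → P.A y = 0 → P.B x y = 0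

/-- The second form vanishes on the radical of the first, and the radicals meet trivially. -/
def Reduced (P : AltPair k) : Prop :=
  P.IsotropicRad ∧ ∀ x, P.A x = 0 → P.B x = 0 → x = 0

/-- The dimension of the radical of the first form. -/
noncomputable def corank (P : AltPair k) : ℕ := finrank k (LinearMap.ker P.A)

/-- The dimension of the underlying space. -/
noncomputable def dim (P : AltPair k) : ℕ := finrank k P.V

theorem eq_zero_right_A {P : AltPair k} {x y : P.V} (h : P.A x = 0) : P.A y x = 0 := by
  rw [← P.altA.neg_eq, h]; simp

/-- `X` is a complement of the radical of `A` in its orthogonal space for `B`. -/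
def IsCore (P : AltPair k) (X : Submodule k P.V) : Prop :=
  Disjoint (LinearMap.ker P.A) X ∧ LinearMap.ker P.A ⊔ X = P.B.orthogonal (LinearMap.ker P.A)

theorem Reduced.exists_isCore {P : AltPair k} (hP : P.Reduced) : ∃ X, P.IsCore X := by
  have hle : LinearMap.ker P.A ≤ P.B.orthogonal (LinearMap.ker P.A) :=
    fun x hx y hy => hP.1 y x hy hx
  obtain ⟨Y, hY⟩ := Submodule.exists_isCompl (LinearMap.ker P.A)
  refine ⟨Y ⊓ P.B.orthogonal (LinearMap.ker P.A), hY.disjoint.mono_right inf_le_left, ?_⟩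
  rw [← sup_inf_assoc_of_le Y hle, hY.sup_eq_top, top_inf_eq]

/-- The radicals meet trivially, so the conditions that the radical of `A` imposes through `B` are
independent. -/
theorem Reduced.finrank_orthogonal {P : AltPair k} (hP : P.Reduced) :
    finrank k (P.B.orthogonal (LinearMap.ker P.A)) + P.corank = P.dim := by
  have := LinearMap.BilinForm.finrank_add_finrank_orthogonal' (B := P.B) (LinearMap.ker P.A)
  have h0 : LinearMap.ker P.A ⊓ LinearMap.ker P.B = ⊥ := by
    rw [eq_bot_iff]
    exact fun x hx => hP.2 x hx.1 hx.2
  rw [h0, finrank_bot, add_zero] at this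
  rw [corank, dim]
  omega

theorem Reduced.finrank_core {P : AltPair k} (hP : P.Reduced) {X : Submodule k P.V}
    (hX : P.IsCore X) : finrank k X + 2 * P.corank = P.dim := by
  have h1 := hP.finrank_orthogonal
  have h2 := Submodule.finrank_sup_add_finrank_inf_eq (LinearMap.ker P.A) X
  rw [hX.2, hX.1.eq_bot, finrank_bot] at h2
  rw [corank] at *
  omega

/-- The radical of `A` is dual to the quotient by its orthogonal space for `B`. -/
theorem Reduced.exists_dual {P : AltPair k} (hP : P.Reduced) :
    ∃ g : Dual k P.V →ₗ[k] P.V, (∀ n, P.A (g n) = 0) ∧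
      ∀ n : Dual k P.V, (∀ u ∈ P.B.orthogonal (LinearMap.ker P.A), n u = 0) → P.B (g n) = n := by
  set R := LinearMap.ker P.A with hR
  set U := P.B.orthogonal R with hU
  let D : R →ₗ[k] Dual k P.V := P.B.domRestrict R
  have hD : LinearMap.ker D = ⊥ := by
    rw [eq_bot_iff]
    intro x hx
    rw [Submodule.mem_bot]
    exact Subtype.ext (hP.2 x x.2 hx)
  obtain ⟨g, hg⟩ := LinearMap.exists_leftInverse_of_injective D hD
  have hrange : LinearMap.range D = U.dualAnnihilator := by
    apply Submodule.eq_of_le_of_finrank_le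
    · rintro _ ⟨r, rfl⟩
      rw [Submodule.mem_dualAnnihilator]
      exact fun u hu => hu r r.2
    · rw [LinearMap.finrank_range_of_inj (LinearMap.ker_eq_bot.mp hD)]
      have h1 := Subspace.finrank_add_finrank_dualAnnihilator_eq U
      have h2 : finrank k U + finrank k R = finrank k P.V := hP.finrank_orthogonal
      omega
  refine ⟨R.subtype ∘ₗ g, fun n => (g n).2, fun n hn => ?_⟩
  obtain ⟨r, rfl⟩ : n ∈ LinearMap.range D := by
    rw [hrange, Submodule.mem_dualAnnihilator]
    exact hn
  have : g (D r) = r := LinearMap.congr_fun hg r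
  rw [LinearMap.comp_apply, this]
  rfl

/-- On a complement of its radical, `A` is nondegenerate. -/
theorem nondegenerate_of_isCompl_ker (P : AltPair k) {Z : Submodule k P.V}
    (hZ : IsCompl (LinearMap.ker P.A) Z) : (P.sub Z).A.Nondegenerate := by
  refine (LinearMap.IsRefl.nondegenerate_iff_separatingLeft (P.sub Z).altA.isRefl).mpr ?_
  intro (z : Z) hz
  have : P.A z = 0 := by
    ext x
    have hx := Submodule.projection_add_projection_eq_self hZ x
    rw [← hx, map_add, eq_zero_right_A (Submodule.projection_apply_mem hZ x), zero_add]
    exact hz ⟨_, Submodule.projection_apply_mem hZ.symm x⟩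
  exact Subtype.ext (Submodule.disjoint_def.mp hZ.disjoint _ this z.2)

/-- A reduced pair is determined by its dimension, its corank and its core. -/
theorem Reduced.iso_of_core_iso {P Q : AltPair k} (hP : P.Reduced) (hQ : Q.Reduced)
    (hdim : P.dim = Q.dim) (hcork : P.corank = Q.corank) {X : Submodule k P.V}
    {X' : Submodule k Q.V} (hX : P.IsCore X) (hX' : Q.IsCore X') (h : (P.sub X).Iso (Q.sub X')) :
    P.Iso Q := by
  obtain ⟨f, fA, fB⟩ := h
  obtain ⟨Z, hXZ, hZ⟩ := hX.1.symm.exists_isCompl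
  obtain ⟨Z', hXZ', hZ'⟩ := hX'.1.symm.exists_isCompl
  have hZfr := Submodule.finrank_add_eq_of_isCompl hZ
  have hZfr' := Submodule.finrank_add_eq_of_isCompl hZ'
  have hZd : finrank k Z = finrank k Z' := by
    rw [corank, corank] at hcork
    rw [dim, dim] at hdim
    omega
  -- The isometry of the complements of the radicals.
  obtain ⟨W, hW⟩ := Submodule.exists_isCompl X
  let f₁ : X ≃ₗ[k] X' := f
  let F : P.V →ₗ[k] Q.V := X'.subtype ∘ₗ f₁.toLinearMap ∘ₗ X.projectionOnto W hW
  have hFX : ∀ x (hx : x ∈ X), F x = f₁ ⟨x, hx⟩ := fun x hx => by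
    simp only [F, LinearMap.comp_apply, Submodule.projectionOnto_apply_of_mem_left hW hx]
    rfl
  have hFmem : ∀ x, F x ∈ X' := fun x => (f₁ _).2
  obtain ⟨Φ, hΦA, hΦX⟩ := exists_witt_extension (P.sub Z).altA (Q.sub Z').altA
    (P.nondegenerate_of_isCompl_ker hZ.symm) (Q.nondegenerate_of_isCompl_ker hZ'.symm) hZd
    (X.comap Z.subtype) (F.restrict fun x _ => hXZ' (hFmem x))
    (by
      intro (x : Z) hx hx0
      have h1 : F x = 0 := congrArg Subtype.val hx0
      rw [hFX x hx] at h1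
      have h2 : f₁ ⟨x, hx⟩ = 0 := Subtype.ext h1
      rw [LinearEquiv.map_eq_zero_iff] at h2
      have h3 : (x : P.V) = 0 := Subtype.ext_iff.mp h2
      exact Subtype.ext h3)
    (by
      intro (x : Z) hx (y : Z) hy
      change Q.A (F x) (F y) = P.A x y
      rw [hFX x hx, hFX y hy]
      exact fA ⟨x, hx⟩ ⟨y, hy⟩)
  let Φ₁ : Z ≃ₗ[k] Z' := Φ
  let p := Z.projection _ hZ
  let π := (LinearMap.ker P.A).projection _ hZ.symm
  -- `G` kills the radical, preserves `A`, and preserves `B` on the core; `Ψ` inverts it modulo the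
  -- radicals.
  let G : P.V →ₗ[k] Q.V := Z'.subtype ∘ₗ Φ₁.toLinearMap ∘ₗ Z.projectionOnto _ hZ
  let Ψ : Q.V →ₗ[k] P.V := Z.subtype ∘ₗ Φ₁.symm.toLinearMap ∘ₗ Z'.projectionOnto _ hZ'
  have hπp : ∀ x, x = π x + p x := fun x =>
    (Submodule.projection_add_projection_eq_self hZ.symm x).symm
  have hπ : ∀ x, P.A (π x) = 0 := fun x => Submodule.projection_apply_mem hZ.symm x
  have hGp : ∀ x, G x = Φ₁ (Z.projectionOnto _ hZ x) := fun x => rfl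
  have hGX : ∀ x (hx : x ∈ X), G x = f₁ ⟨x, hx⟩ := fun x hx => by
    rw [hGp, Submodule.projectionOnto_apply_of_mem_left hZ (hXZ hx), ← hFX x hx]
    exact congrArg Subtype.val (hΦX ⟨x, hXZ hx⟩ hx)
  have hΨG : ∀ x, Ψ (G x) = p x := fun x => by
    simp only [Ψ, LinearMap.comp_apply, hGp, Submodule.projectionOnto_apply_left]
    simp [p]
  have hΨR : ∀ y, Q.A y = 0 → Ψ y = 0 := fun y hy => by
    simp only [Ψ, LinearMap.comp_apply, (Submodule.projectionOnto_apply_eq_zero_iff hZ').mpr hy,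
      map_zero]
  have hpX : ∀ x ∈ X, p x = x := fun x hx =>
    Submodule.projection_apply_of_mem_left hZ (hXZ hx)
  have hΨX : ∀ y ∈ X', Ψ y ∈ X := fun y hy => by
    obtain ⟨x, hx⟩ := f₁.surjective ⟨y, hy⟩
    have : y = G x := by rw [hGX x x.2, hx]
    rw [this, hΨG, hpX x x.2]
    exact x.2
  have hGA : ∀ x y, Q.A (G x) (G y) = P.A x y := fun x y => by
    conv_rhs => rw [hπp x, hπp y]
    simp only [map_add, hπ, eq_zero_right_A (hπ y), zero_add]
    exact hΦA _ _
  have hGB : ∀ x ∈ X, ∀ y ∈ X, Q.B (G x) (G y) = P.B x y := fun x hx y hy => by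
    rw [hGX x hx, hGX y hy]
    exact fB ⟨x, hx⟩ ⟨y, hy⟩
  -- The correction along the radical.
  have hpp : ∀ x, p (p x) = p x := fun x =>
    Submodule.projection_apply_of_mem_left hZ (Submodule.projection_apply_mem hZ x)
  have hGpp : ∀ x, G (p x) = G x := fun x => by
    rw [hGp, hGp, ← Submodule.coe_projectionOnto_apply, Submodule.projectionOnto_apply_left]
  have hE : (P.B.compl₁₂ p p - Q.B.compl₁₂ G G).IsAlt := fun x => by
    simp [P.altB.self_eq_zero, Q.altB.self_eq_zero]
  obtain ⟨b, hb, hbX⟩ := LinearMap.BilinForm.IsAlt.exists_sub_flip_of_isotropic hE X fun x hx y hy => by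
    simp [hpX x hx, hpX y hy, hGB x hx y hy]
  obtain ⟨g, hgA, hgB⟩ := hQ.exists_dual
  -- Adding `g ∘ L` to `G` moves values only inside the radical, so `A` is untouched, while `B`
  -- changes by L x (G y) - L y (G x). The first summand of `L` supplies the products with `π`, the
  -- second the defect of `G`, written as `b` minus its transpose. By `hbX`, `L x` vanishes on the
  -- space orthogonal to the radical, as `hgB` requires.
  let L : P.V →ₗ[k] Dual k Q.V :=
    (LinearMap.lcomp k k Ψ) ∘ₗ (P.B ∘ₗ π + b ∘ₗ p)
  have hL : ∀ x y, L x y = P.B (π x) (Ψ y) + b (p x) (Ψ y) := fun x y => rfl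
  have hLB : ∀ x, Q.B (g (L x)) = L x := fun x => by
    apply hgB
    intro u hu
    rw [← hX'.2] at hu
    obtain ⟨r, hr, y, hy, rfl⟩ := Submodule.mem_sup.mp hu
    rw [map_add, hL, hL, hΨR r hr, hbX _ _ (hΨX y hy)]
    have h1 : Ψ y ∈ P.B.orthogonal (LinearMap.ker P.A) := by
      rw [← hX.2]
      exact Submodule.mem_sup_right (hΨX y hy)
    have h2 : P.B (π x) (Ψ y) = 0 := h1 _ (hπ x)
    simp [h2]
  let φ : P.V →ₗ[k] Q.V := g ∘ₗ L + G
  have hφ : ∀ x, φ x = g (L x) + G x := fun x => rfl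
  have hφA : ∀ x y, Q.A (φ x) (φ y) = P.A x y := fun x y => by
    rw [hφ, hφ]
    simp only [map_add, hgA, eq_zero_right_A (hgA _), zero_add, hGA]
  have hφB : ∀ x y, Q.B (φ x) (φ y) = P.B x y := fun x y => by
    have h1 : L x (g (L y)) = 0 := by
      rw [← hLB]
      exact hQ.1 _ _ (hgA _) (hgA _)
    have h2 : P.B (π x) (π y) = 0 := hP.1 _ _ (hπ _) (hπ _)
    have h3 : b (p x) (p y) - b (p y) (p x) = P.B (p x) (p y) - Q.B (G x) (G y) := by
      rw [hb, LinearMap.sub_apply, LinearMap.sub_apply, LinearMap.compl₁₂_apply,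
        LinearMap.compl₁₂_apply, hpp, hpp, hGpp, hGpp]
    rw [hφ, hφ]
    conv_rhs => rw [hπp x, hπp y]
    simp only [map_add, LinearMap.add_apply, h1, h2, hLB]
    rw [← Q.altB.neg_eq (g (L y)) (G x), hLB, hL x (G y), hL y (G x), hΨG, hΨG, ← P.altB.neg_eq (π y) (p x)]
    linear_combination h3
  have hinj : Function.Injective φ := by
    rw [injective_iff_map_eq_zero]
    intro x hx
    refine hP.2 x ?_ ?_
    · ext y; rw [← hφA, hx]; simp
    · ext y; rw [← hφB, hx]; simp
  exact ⟨LinearEquiv.ofInjectiveOfFinrankEq φ hinj hdim, hφA, hφB⟩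

end AltPair


/-! ### Numbers of isometry classes -/

namespace AltPair

variable {k : Type} [Field k]

/-- The isometry classes that meet a set of pairs. -/
def classes (S : Set (AltPair k)) : Set (Quotient (setoid k)) := Quotient.mk _ '' S

/-- Transport of a pair along a linear isomorphism. -/
def transport (P : AltPair k) {V : Type} [AddCommGroup V] [Module k V] [FiniteDimensional k V]
    (e : P.V ≃ₗ[k] V) : AltPair k where
  V := V
  A := P.A.compl₁₂ e.symm.toLinearMap e.symm.toLinearMap
  B := P.B.compl₁₂ e.symm.toLinearMap e.symm.toLinearMap
  altA _ := P.altA _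
  altB _ := P.altB _

theorem iso_transport (P : AltPair k) {V : Type} [AddCommGroup V] [Module k V]
    [FiniteDimensional k V] (e : P.V ≃ₗ[k] V) : P.Iso (P.transport e) :=
  ⟨e, fun x y => by change P.A (e.symm (e x)) (e.symm (e y)) = _; simp,
    fun x y => by change P.B (e.symm (e x)) (e.symm (e y)) = _; simp⟩

/-- `Set.ncard` is zero on infinite sets, so the counts below need this finiteness. -/
theorem finite_classes_dim [Finite k] (d : ℕ) : (classes {P : AltPair k | P.dim = d}).Finite := by
  let X := {F : LinearMap.BilinForm k (Fin d → k) × LinearMap.BilinForm k (Fin d → k) //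
    F.1.IsAlt ∧ F.2.IsAlt}
  have : Finite (LinearMap.BilinForm k (Fin d → k)) :=
    Module.finite_of_finite k
  let m : X → Quotient (setoid k) := fun F => ⟦⟨Fin d → k, F.1.1, F.1.2, F.2.1, F.2.2⟩⟧
  refine (Set.finite_range m).subset ?_
  rintro _ ⟨P, hP, rfl⟩
  let e : P.V ≃ₗ[k] (Fin d → k) := LinearEquiv.ofFinrankEq _ _ ((Module.finrank_fin_fun k).symm ▸ hP)
  refine ⟨⟨((P.transport e).A, (P.transport e).B), (P.transport e).altA, (P.transport e).altB⟩, ?_⟩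
  exact Quotient.sound (P.iso_transport e).symm

theorem finite_classes_of_dim [Finite k] {S : Set (AltPair k)} (d : ℕ) (h : ∀ P ∈ S, P.dim = d) :
    (classes S).Finite :=
  (finite_classes_dim d).subset (Set.image_mono h)

/-- If each pair in `S` is determined up to isometry by an index `i` and by a related pair in
`T i`, the classes of `S` are no more than those of the `T i` together. -/
theorem ncard_classes_le {ι : Type*} (I : Finset ι) (S : Set (AltPair k))
    (T : ι → Set (AltPair k)) (hT : ∀ i, (classes (T i)).Finite)
    (rel : ι → AltPair k → AltPair k → Prop)
    (h1 : ∀ P ∈ S, ∃ i ∈ I, ∃ P' ∈ T i, rel i P P')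
    (h2 : ∀ i, ∀ P ∈ S, ∀ Q ∈ S, ∀ P' Q', rel i P P' → rel i Q Q' → P'.Iso Q' → P.Iso Q) :
    (classes S).ncard ≤ ∑ i ∈ I, (classes (T i)).ncard := by
  classical
  rcases S.eq_empty_or_nonempty with rfl | ⟨P₀, hP₀⟩
  · simp [classes]
  have hne : Nonempty (ι × AltPair k) := by
    obtain ⟨i, -, P', -⟩ := h1 P₀ hP₀
    exact ⟨(i, P')⟩
  have h3 : ∀ c : Quotient (setoid k), ∃ x : ι × AltPair k, c ∈ classes S →
      x.1 ∈ I ∧ x.2 ∈ T x.1 ∧ ∃ P ∈ S, ⟦P⟧ = c ∧ rel x.1 P x.2 := by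
    intro c
    by_cases hc : c ∈ classes S
    · obtain ⟨P, hP, rfl⟩ := hc
      obtain ⟨i, hi, P', hP', hr⟩ := h1 P hP
      exact ⟨(i, P'), fun _ => ⟨hi, hP', P, hP, rfl, hr⟩⟩
    · exact ⟨hne.some, fun h => absurd h hc⟩
  choose F hF using h3
  let T' : Finset (Σ _ : ι, Quotient (setoid k)) := I.sigma fun i => (hT i).toFinset
  have hcard : T'.card = ∑ i ∈ I, (classes (T i)).ncard := by
    rw [Finset.card_sigma]
    exact Finset.sum_congr rfl fun i _ => (Set.ncard_eq_toFinset_card _ (hT i)).symm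
  rw [← hcard, ← Set.ncard_coe_finset]
  refine Set.ncard_le_ncard_of_injOn (fun c => ⟨(F c).1, ⟦(F c).2⟧⟩) ?_ ?_ (Finset.finite_toSet _)
  · intro c hc
    obtain ⟨hi, hT, -⟩ := hF c hc
    simp only [T', Finset.coe_sigma, Set.mem_sigma_iff]
    exact ⟨hi, by simpa using ⟨_, hT, rfl⟩⟩
  · intro c hc c' hc' h
    obtain ⟨-, -, P, hP, rfl, hr⟩ := hF c hc
    obtain ⟨-, -, Q, hQ, rfl, hr'⟩ := hF c' hc'
    simp only [Sigma.mk.injEq, heq_eq_eq] at h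
    rw [h.1] at hr
    exact Quotient.sound (h2 _ P hP Q hQ _ _ hr hr' (Quotient.exact h.2))

/-- Pairs of given dimension and corank. -/
def pairs (k : Type) [Field k] (d r : ℕ) : Set (AltPair k) := {P | P.dim = d ∧ P.corank = r}

theorem corank_le_dim (P : AltPair k) : P.corank ≤ P.dim := Submodule.finrank_le _

theorem sub_A_eq_zero_iff {P : AltPair k} {S T : Submodule k P.V} (h : IsCompl S T)
    (hS : S ≤ LinearMap.ker P.A) (x : T) : (P.sub T).A x = 0 ↔ P.A x = 0 := by
  refine ⟨fun hx => ?_, fun hx => ?_⟩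
  · ext y
    have hy := Submodule.projection_add_projection_eq_self h y
    rw [← hy, map_add, eq_zero_right_A (hS (Submodule.projection_apply_mem h y)), zero_add]
    exact LinearMap.congr_fun hx ⟨_, Submodule.projection_apply_mem h.symm y⟩
  · refine LinearMap.ext fun (y : T) => ?_
    rw [sub_A, hx]
    rfl

theorem corank_sub {P : AltPair k} {S T : Submodule k P.V} (h : IsCompl S T)
    (hS : S ≤ LinearMap.ker P.A) : (P.sub T).corank + finrank k S = P.corank := by
  have h1 : LinearMap.ker (P.sub T).A = (LinearMap.ker P.A).comap T.subtype := by
    refine Submodule.ext fun (x : T) => ?_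
    exact sub_A_eq_zero_iff h hS x
  have h2 : S ⊔ (T ⊓ LinearMap.ker P.A) = LinearMap.ker P.A := by
    rw [← sup_inf_assoc_of_le T hS, h.sup_eq_top, top_inf_eq]
  have h3 : S ⊓ (T ⊓ LinearMap.ker P.A) = ⊥ := by
    rw [← inf_assoc, h.inf_eq_bot, bot_inf_eq]
  have h4 := Submodule.finrank_sup_add_finrank_inf_eq S (T ⊓ LinearMap.ker P.A)
  rw [h2, h3, finrank_bot, ← Submodule.map_comap_subtype, Submodule.finrank_map_subtype_eq] at h4
  have h5 : (P.sub T).corank = finrank k ((LinearMap.ker P.A).comap T.subtype) :=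
    congrArg (fun K : Submodule k T => finrank k K) h1
  rw [h5, corank]
  omega

theorem dim_sub {P : AltPair k} {S T : Submodule k P.V} (h : IsCompl S T) :
    (P.sub T).dim + finrank k S = P.dim := by
  have := Submodule.finrank_add_eq_of_isCompl h
  have h' : (P.sub T).dim = finrank k T := rfl
  rw [h', dim]
  omega

theorem sub_mem_pairs {P : AltPair k} {d r s : ℕ} (hP : P ∈ pairs k d r) {S T : Submodule k P.V}
    (h : IsCompl S T) (hS : S ≤ LinearMap.ker P.A) (hs : finrank k S = s) :
    P.sub T ∈ pairs k (d - s) (r - s) := by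
  have h1 := dim_sub h
  have h2 := corank_sub h hS
  rw [hs, hP.1] at h1
  rw [hs, hP.2] at h2
  exact ⟨by omega, by omega⟩

/-- A complement in the radical of `A` of the part of it that is orthogonal to it for `B`. -/
theorem exists_nondegenerate_sub_ker (P : AltPair k) :
    ∃ S ≤ LinearMap.ker P.A, (P.B.restrict S).Nondegenerate ∧
      (P.sub (P.B.orthogonal S)).IsotropicRad := by
  set R := LinearMap.ker P.A with hR
  set R₁ := R ⊓ P.B.orthogonal R with hR₁
  obtain ⟨Y, hY⟩ := Submodule.exists_isCompl R₁
  have hsup : R₁ ⊔ (Y ⊓ R) = R := by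
    rw [← sup_inf_assoc_of_le Y inf_le_left, hY.sup_eq_top, top_inf_eq]
  have hdis : ∀ s ∈ Y ⊓ R, (∀ t ∈ Y ⊓ R, P.B s t = 0) → s = 0 := by
    intro s hs h
    refine Submodule.disjoint_def.mp hY.disjoint s ⟨hs.2, fun t ht => ?_⟩ hs.1
    rw [← hsup] at ht
    obtain ⟨a, ha, b, hb, rfl⟩ := Submodule.mem_sup.mp ht
    have h1 : P.B s a = 0 := ha.2 s hs.2
    change P.B (a + b) s = 0
    rw [← P.altB.neg_eq, map_add, h1, h b hb, add_zero, neg_zero]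
  have hnd : (P.B.restrict (Y ⊓ R)).Nondegenerate := by
    refine (LinearMap.IsRefl.nondegenerate_iff_separatingLeft (P.sub (Y ⊓ R)).altB.isRefl).mpr ?_
    intro (s : (Y ⊓ R : Submodule k P.V)) hs
    exact Subtype.ext (hdis s s.2 fun t ht => hs ⟨t, ht⟩)
  refine ⟨Y ⊓ R, inf_le_right, hnd, ?_⟩
  have hcompl := LinearMap.BilinForm.isCompl_orthogonal_of_restrict_nondegenerate P.altB.isRefl hnd
  intro (x : P.B.orthogonal (Y ⊓ R)) (y : P.B.orthogonal (Y ⊓ R)) hx hy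
  rw [sub_A_eq_zero_iff hcompl inf_le_right] at hx hy
  rw [sub_B]
  have hx' : (x : P.V) ∈ R₁ ⊔ (Y ⊓ R) := by rw [hsup]; exact hx
  obtain ⟨a, ha, b, hb, hab⟩ := Submodule.mem_sup.mp hx'
  have hb0 : b = 0 := by
    refine hdis b hb fun t ht => ?_
    have h1 : P.B t x = 0 := x.2 t ht
    have h2 : P.B t a = 0 := ha.2 t ht.2
    rw [← hab, map_add, h2, zero_add] at h1
    rw [← P.altB.neg_eq, h1, neg_zero]
  rw [← hab, hb0, add_zero, ← P.altB.neg_eq]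
  have : P.B y a = 0 := ha.2 y hy
  rw [this, neg_zero]

/-- Here `s` is the dimension of a summand inside the radical of `A` on which `B` is nondegenerate.
It is a symplectic space with zero first form, hence determined by `s`. -/
theorem ncard_pairs_le [Finite k] (d r : ℕ) :
    (classes (pairs k d r)).ncard ≤ ∑ s ∈ Finset.range (r + 1),
      (classes (pairs k (d - s) (r - s) ∩ {P | P.IsotropicRad})).ncard := by
  refine ncard_classes_le _ _ _ (fun s => finite_classes_of_dim (d - s) fun P hP => hP.1.1)
    (fun s P P' => ∃ S ≤ LinearMap.ker P.A, finrank k S = s ∧ (P.B.restrict S).Nondegenerate ∧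
      P' = P.sub (P.B.orthogonal S)) ?_ ?_
  · intro P hP
    obtain ⟨S, hS, hnd, hiso⟩ := P.exists_nondegenerate_sub_ker
    have hcompl :=
      LinearMap.BilinForm.isCompl_orthogonal_of_restrict_nondegenerate P.altB.isRefl hnd
    refine ⟨finrank k S, ?_, _, ⟨sub_mem_pairs hP hcompl hS rfl, hiso⟩, S, hS, rfl, hnd, rfl⟩
    have := Submodule.finrank_mono hS
    have h2 := hP.2
    rw [corank] at h2
    rw [Finset.mem_range]
    omega
  · rintro s P - Q - _ _ ⟨S, hS, hs, hnd, rfl⟩ ⟨S', hS', hs', hnd', rfl⟩ hiso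
    refine iso_of_isCompl
      (LinearMap.BilinForm.isCompl_orthogonal_of_restrict_nondegenerate P.altB.isRefl hnd)
      (LinearMap.BilinForm.isCompl_orthogonal_of_restrict_nondegenerate Q.altB.isRefl hnd')
      ?_ ?_ ?_ ?_ ?_ hiso
    · intro x hx y _; rw [show P.A x = 0 from hS hx]; rfl
    · exact fun x hx y hy => hy x hx
    · intro x hx y _; rw [show Q.A x = 0 from hS' hx]; rfl
    · exact fun x hx y hy => hy x hx
    · obtain ⟨Φ, hΦ, -⟩ := exists_witt_extension (P.sub S).altB (Q.sub S').altB hnd hnd'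
        (hs.trans hs'.symm) ⊥ 0 (by simp) (by simp)
      let Φ₁ : S ≃ₗ[k] S' := Φ
      refine ⟨Φ, fun (x : S) (y : S) => ?_, hΦ⟩
      have h1 : P.A x = 0 := hS x.2
      have h2 : Q.A (Φ₁ x) = 0 := hS' (Φ₁ x).2
      change Q.A (Φ₁ x) (Φ₁ y) = P.A x y
      rw [h1, h2]
      rfl

/-- The common radical, of dimension `s`, splits off with both forms zero. -/
theorem ncard_isotropicRad_le [Finite k] (d r : ℕ) :
    (classes (pairs k d r ∩ {P | P.IsotropicRad})).ncard ≤ ∑ s ∈ Finset.range (r + 1),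
      (classes (pairs k (d - s) (r - s) ∩ {P | P.Reduced})).ncard := by
  refine ncard_classes_le _ _ _ (fun s => finite_classes_of_dim (d - s) fun P hP => hP.1.1)
    (fun s P P' => ∃ S T, IsCompl S T ∧ S ≤ LinearMap.ker P.A ∧ S ≤ LinearMap.ker P.B ∧
      finrank k S = s ∧ P' = P.sub T) ?_ ?_
  · rintro P ⟨hP, hiso⟩
    obtain ⟨T, hT⟩ := Submodule.exists_isCompl (LinearMap.ker P.A ⊓ LinearMap.ker P.B)
    refine ⟨finrank k (LinearMap.ker P.A ⊓ LinearMap.ker P.B : Submodule k P.V), ?_, _,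
      ⟨sub_mem_pairs hP hT inf_le_left rfl, ?_⟩, _, T, hT, inf_le_left, inf_le_right, rfl, rfl⟩
    · have := Submodule.finrank_mono
        (inf_le_left : LinearMap.ker P.A ⊓ LinearMap.ker P.B ≤ LinearMap.ker P.A)
      have h2 := hP.2
      rw [corank] at h2
      rw [Finset.mem_range]
      omega
    · refine ⟨fun (x : T) (y : T) hx hy => ?_, fun (x : T) hx hx' => ?_⟩
      · rw [sub_A_eq_zero_iff hT inf_le_left] at hx hy
        exact hiso _ _ hx hy
      · rw [sub_A_eq_zero_iff hT inf_le_left] at hx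
        have hB : P.B x = 0 := by
          ext y
          have hy := Submodule.projection_add_projection_eq_self hT y
          have hz : P.B ((LinearMap.ker P.A ⊓ LinearMap.ker P.B).projection T hT y) = 0 :=
            (Submodule.projection_apply_mem hT y).2
          rw [← hy, map_add, ← P.altB.neg_eq, hz, LinearMap.zero_apply, neg_zero, zero_add]
          exact LinearMap.congr_fun hx' ⟨_, Submodule.projection_apply_mem hT.symm y⟩
        exact Subtype.ext (Submodule.disjoint_def.mp hT.disjoint _ ⟨hx, hB⟩ x.2)
  · rintro s P - Q - _ _ ⟨S, T, hST, hSA, hSB, hs, rfl⟩ ⟨S', T', hST', hSA', hSB', hs', rfl⟩ hiso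
    have h0 : ∀ {R : AltPair k} {F : LinearMap.BilinForm k R.V} {U : Submodule k R.V},
        U ≤ LinearMap.ker F → ∀ x ∈ U, ∀ y, F x y = 0 := by
      intro R F U hU x hx y
      rw [show F x = 0 from hU hx]
      rfl
    refine iso_of_isCompl hST hST' (fun x hx y _ => h0 hSA x hx y) (fun x hx y _ => h0 hSB x hx y)
      (fun x hx y _ => h0 hSA' x hx y) (fun x hx y _ => h0 hSB' x hx y) ?_ hiso
    let Φ : S ≃ₗ[k] S' := LinearEquiv.ofFinrankEq _ _ (hs.trans hs'.symm)
    exact ⟨Φ, fun (x : S) (y : S) => (h0 hSA' _ (Φ x).2 _).trans (h0 hSA _ x.2 _).symm,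
      fun (x : S) (y : S) => (h0 hSB' _ (Φ x).2 _).trans (h0 hSB _ x.2 _).symm⟩

/-- Let `Z ⊇ X` be a complement of the radical. It is symplectic of dimension `dim - corank`, so the
orthogonal space of `X` in it has dimension `corank`; that space contains the radical of `A` on `X`.
-/
theorem IsCore.corank_le {P : AltPair k} (hP : P.Reduced) {X : Submodule k P.V}
    (hX : P.IsCore X) : (P.sub X).corank ≤ P.corank := by
  obtain ⟨Z, hXZ, hZ⟩ := hX.1.symm.exists_isCompl
  have hn : (P.A.restrict Z).Nondegenerate := P.nondegenerate_of_isCompl_ker hZ.symm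
  have h1 := LinearMap.BilinForm.finrank_orthogonal hn (X.comap Z.subtype)
  rw [(Submodule.comapSubtypeEquivOfLe hXZ).finrank_eq] at h1
  let K : Submodule k X := LinearMap.ker (P.sub X).A
  have h2 : K.map (Submodule.inclusion hXZ) ≤
      (P.A.restrict Z).orthogonal (X.comap Z.subtype) := by
    rintro _ ⟨x, hx, rfl⟩ y hy
    change P.A y x = 0
    rw [← P.altA.neg_eq, neg_eq_zero]
    exact LinearMap.congr_fun hx ⟨y, hy⟩
  have h3 := Submodule.finrank_mono h2
  rw [((Submodule.equivMapOfInjective _ (Submodule.inclusion_injective hXZ) K).finrank_eq).symm,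
    h1] at h3
  have h4 := hP.finrank_core hX
  have h5 := Submodule.finrank_add_eq_of_isCompl hZ
  have h6 : (P.sub X).corank = finrank k K := rfl
  rw [corank, dim] at h4
  rw [h6, corank]
  omega

/-- The core determines a reduced pair of given dimension and corank, and its own corank `s` does
not exceed `r`. -/
theorem ncard_reduced_le [Finite k] (d r : ℕ) :
    (classes (pairs k d r ∩ {P | P.Reduced})).ncard ≤ ∑ s ∈ Finset.range (r + 1),
      (classes (pairs k (d - 2 * r) s)).ncard := by
  refine ncard_classes_le _ _ _ (fun s => finite_classes_of_dim (d - 2 * r) fun P hP => hP.1)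
    (fun _ P P' => ∃ X, P.IsCore X ∧ P' = P.sub X) ?_ ?_
  · rintro P ⟨hP, hred⟩
    obtain ⟨X, hX⟩ := hred.exists_isCore
    refine ⟨(P.sub X).corank, ?_, _, ⟨?_, rfl⟩, X, hX, rfl⟩
    · rw [Finset.mem_range, Nat.lt_succ_iff, ← hP.2]
      exact hX.corank_le hred
    · have h1 := hred.finrank_core hX
      rw [hP.1, hP.2] at h1
      have h2 : (P.sub X).dim = finrank k X := rfl
      omega
  · rintro s P ⟨hP, hred⟩ Q ⟨hQ, hred'⟩ _ _ ⟨X, hX, rfl⟩ ⟨X', hX', rfl⟩ hiso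
    exact hred.iso_of_core_iso hred' (hP.1.trans hQ.1.symm) (hP.2.trans hQ.2.symm) hX hX' hiso

end AltPair


/-! ### Pairs whose first form is nondegenerate -/

section FrobeniusFunctional

variable {k : Type*} [Field k]

/-- The coefficient of `X ^ (natDegree f - 1)` in the remainder modulo `f`. -/
noncomputable def topCoeff (f : k[X]) : k[X] →ₗ[k] k :=
  (lcoeff k (f.natDegree - 1)).comp (modByMonicHom f)

theorem topCoeff_apply (f g : k[X]) : topCoeff f g = (g %ₘ f).coeff (f.natDegree - 1) := rfl

theorem topCoeff_of_dvd {f g : k[X]} (hf : f.Monic) (h : f ∣ g) : topCoeff f g = 0 := by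
  rw [topCoeff_apply, (modByMonic_eq_zero_iff_dvd hf).mpr h, coeff_zero]

/-- The kernel of `topCoeff f` contains no ideal that is larger than the ideal of `f`. -/
theorem dvd_of_topCoeff {f g : k[X]} (hf : f.Monic) (h : ∀ j, topCoeff f (g * X ^ j) = 0) :
    f ∣ g := by
  rw [← modByMonic_eq_zero_iff_dvd hf]
  set r := g %ₘ f with hr
  by_contra hr0
  have hf1 : f ≠ 1 := by
    rintro rfl
    exact hr0 (modByMonic_one g)
  have hlt : r.natDegree < f.natDegree := natDegree_modByMonic_lt g hf hf1
  -- This shift brings the leading coefficient of the remainder into degree `natDegree f - 1`.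
  have h1 := h (f.natDegree - 1 - r.natDegree)
  have h2 : g * X ^ (f.natDegree - 1 - r.natDegree) =
      r * X ^ (f.natDegree - 1 - r.natDegree) +
        f * ((g /ₘ f) * X ^ (f.natDegree - 1 - r.natDegree)) := by
    conv_lhs => rw [← modByMonic_add_div g f]
    ring
  rw [h2, map_add, topCoeff_of_dvd hf (dvd_mul_right _ _), add_zero, topCoeff_apply,
    (modByMonic_eq_self_iff hf).mpr] at h1
  · have h3 : f.natDegree - 1 = r.natDegree + (f.natDegree - 1 - r.natDegree) := by omega
    nth_rw 2 [h3] at h1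
    rw [coeff_mul_X_pow] at h1
    exact hr0 (leadingCoeff_eq_zero.mp h1)
  · rw [degree_mul, degree_X_pow, degree_eq_natDegree hr0, degree_eq_natDegree hf.ne_zero]
    norm_cast
    omega

end FrobeniusFunctional

/-- A finitely generated torsion module over a principal ideal domain has an element whose
annihilator is that of the whole module. -/
theorem exists_ker_aeval_apply_eq {k V : Type*} [Field k] [AddCommGroup V] [Module k V]
    [FiniteDimensional k V] (T : End k V) :
    ∃ v : V, ∀ p : k[X], aeval T p v = 0 ↔ minpoly k T ∣ p := by
  obtain ⟨x, hx⟩ := Module.exists_ker_toSpanSingleton_eq_annihilator k[X] (AEval' T)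
  obtain ⟨v, rfl⟩ := (AEval'.of T).surjective x
  refine ⟨v, fun p => ?_⟩
  rw [← span_minpoly_eq_annihilator] at hx
  rw [← Ideal.mem_span_singleton, ← hx, LinearMap.mem_ker, LinearMap.toSpanSingleton_apply,
    ← AEval.of_aeval_smul, LinearEquiv.map_eq_zero_iff]
  rfl

namespace AltPair

variable {k : Type} [Field k]

/-- `T` is the operator that transforms `A` into `B`. -/
def IsOp (P : AltPair k) (T : End k P.V) : Prop := ∀ x y, P.B x y = P.A (T x) y

theorem nondegenerate_of_corank {P : AltPair k} (hP : P.corank = 0) : P.A.Nondegenerate := by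
  refine (LinearMap.IsRefl.nondegenerate_iff_separatingLeft P.altA.isRefl).mpr ?_
  rw [LinearMap.separatingLeft_iff_ker_eq_bot]
  exact Submodule.finrank_eq_zero.mp hP

theorem exists_isOp {P : AltPair k} (hP : P.A.Nondegenerate) : ∃ T, P.IsOp T :=
  ⟨(LinearMap.BilinForm.toDual P.A hP).symm.toLinearMap ∘ₗ P.B, fun x y => by
    simp [LinearMap.BilinForm.apply_toDual_symm_apply]⟩

namespace IsOp

variable {P : AltPair k} {T : End k P.V}

theorem apply_comm (hT : P.IsOp T) (x y : P.V) : P.A (T x) y = P.A x (T y) := by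
  rw [← hT, ← P.altB.neg_eq, hT, P.altA.neg_eq]

theorem aeval_comm (hT : P.IsOp T) (p : k[X]) (x y : P.V) :
    P.A (aeval T p x) y = P.A x (aeval T p y) := by
  induction p using Polynomial.induction_on generalizing x y with
  | C a => simp
  | add p q hp hq => simp [hp, hq]
  | monomial n a h =>
    have e : (C a * X ^ (n + 1) : k[X]) = C a * X ^ n * X := by ring
    rw [e, map_mul (aeval T), Module.End.mul_apply, Module.End.mul_apply, h, aeval_X,
      hT.apply_comm, ← Module.End.mul_apply, ← Module.End.mul_apply]
    have hcomm : Commute T (aeval T (C a * X ^ n : k[X])) := by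
      have := Commute.all (X : k[X]) (C a * X ^ n)
      simpa only [aeval_X] using this.map (aeval T)
    rw [hcomm.eq]

/-- Powers come down two at a time, A(T^(n+2) x, x) = A(T^n (Tx), Tx), until `A` or `B` being
alternating applies. In characteristic two self-adjointness alone would not suffice. -/
theorem aeval_self (hT : P.IsOp T) (p : k[X]) (x : P.V) : P.A (aeval T p x) x = 0 := by
  have key : ∀ n x, P.A ((T ^ n) x) x = 0 := by
    intro n
    induction n using Nat.twoStepInduction with
    | zero => intro x; exact P.altA x
    | one => intro x; rw [pow_one, ← hT]; exact P.altB x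
    | more n ih _ =>
      intro x
      rw [pow_succ', pow_succ, Module.End.mul_apply, Module.End.mul_apply, hT.apply_comm]
      exact ih (T x)
  induction p using Polynomial.induction_on with
  | C a => simp [P.altA.self_eq_zero]
  | add p q hp hq => simp [hp, hq]
  | monomial n a _ => simp [key]

end IsOp

/-- `P` is the orthogonal sum of `P'` and of the block that belongs to the polynomial `f`. -/
def Block (f : k[X]) (P P' : AltPair k) : Prop :=
  ∃ Ψ : (k[X] × k[X]) →ₗ[k] P.V,
    (∀ x y, P.A (Ψ x) (Ψ y) = topCoeff f (x.1 * y.2 - x.2 * y.1)) ∧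
    (∀ x y, P.B (Ψ x) (Ψ y) = topCoeff f (X * (x.1 * y.2 - x.2 * y.1))) ∧
    (∀ x, Ψ x = 0 ↔ f ∣ x.1 ∧ f ∣ x.2) ∧
    IsCompl (LinearMap.range Ψ) (P.A.orthogonal (LinearMap.range Ψ)) ∧
    (∀ x, ∀ y ∈ P.A.orthogonal (LinearMap.range Ψ), P.B (Ψ x) y = 0) ∧
    P' = P.sub (P.A.orthogonal (LinearMap.range Ψ))

/-- Both blocks are the quotient of `k[X] × k[X]` by the same kernel, with forms given by the same
formulas in `f`. -/
theorem Block.iso {f : k[X]} {P Q P' Q' : AltPair k} (h : Block f P P') (h' : Block f Q Q')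
    (hiso : P'.Iso Q') : P.Iso Q := by
  obtain ⟨Ψ, hA, hB, h0, hc, hBo, rfl⟩ := h
  obtain ⟨Ψ', hA', hB', h0', hc', hBo', rfl⟩ := h'
  have hker : LinearMap.ker Ψ = LinearMap.ker Ψ' := by
    ext x
    rw [LinearMap.mem_ker, LinearMap.mem_ker, h0, h0']
  let e : LinearMap.range Ψ ≃ₗ[k] LinearMap.range Ψ' :=
    Ψ.quotKerEquivRange.symm.trans ((Submodule.quotEquivOfEq _ _ hker).trans Ψ'.quotKerEquivRange)
  have he : ∀ x, (e ⟨Ψ x, x, rfl⟩ : Q.V) = Ψ' x := by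
    intro x
    have : Ψ.quotKerEquivRange.symm ⟨Ψ x, x, rfl⟩ = Submodule.Quotient.mk x := by
      rw [LinearEquiv.symm_apply_eq]
      rfl
    simp only [e, LinearEquiv.trans_apply, this]
    rfl
  refine iso_of_isCompl hc hc' (fun x hx y hy => hy x hx) ?_ (fun x hx y hy => hy x hx) ?_
    ⟨e, ?_, ?_⟩ hiso
  · rintro _ ⟨x, rfl⟩ y hy
    exact hBo x y hy
  · rintro _ ⟨x, rfl⟩ y hy
    exact hBo' x y hy
  · rintro ⟨_, x, rfl⟩ ⟨_, y, rfl⟩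
    change Q.A (e ⟨Ψ x, x, rfl⟩ : Q.V) (e ⟨Ψ y, y, rfl⟩ : Q.V) = P.A (Ψ x) (Ψ y)
    rw [he, he, hA, hA']
  · rintro ⟨_, x, rfl⟩ ⟨_, y, rfl⟩
    change Q.B (e ⟨Ψ x, x, rfl⟩ : Q.V) (e ⟨Ψ y, y, rfl⟩ : Q.V) = P.B (Ψ x) (Ψ y)
    rw [he, he, hB, hB']

/-- `topCoeff` factors through k[T]v ≅ k[X]/f; extended to the whole space and represented by `A` it
yields `w`. The sign of `l` accounts for `w` standing on the right. -/
theorem exists_frobenius_pair {P : AltPair k} (hP : P.A.Nondegenerate) {T : End k P.V} :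
    ∃ v w : P.V, (∀ p : k[X], aeval T p v = 0 ↔ minpoly k T ∣ p) ∧
      ∀ p : k[X], P.A (aeval T p v) w = topCoeff (minpoly k T) p := by
  obtain ⟨v, hv⟩ := exists_ker_aeval_apply_eq T
  let e : k[X] →ₗ[k] P.V := (LinearMap.applyₗ v).comp (aeval T).toLinearMap
  have he : ∀ p, e p = aeval T p v := fun p => rfl
  have hmem : topCoeff (minpoly k T) ∈ (LinearMap.ker e).dualAnnihilator := by
    rw [Submodule.mem_dualAnnihilator]
    intro p hp
    exact topCoeff_of_dvd (minpoly.monic (Algebra.IsIntegral.isIntegral T)) ((hv p).mp hp)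
  rw [← LinearMap.range_dualMap_eq_dualAnnihilator_ker] at hmem
  obtain ⟨l, hl⟩ := hmem
  refine ⟨v, (LinearMap.BilinForm.toDual P.A hP).symm (-l), hv, fun p => ?_⟩
  rw [← P.altA.neg_eq, LinearMap.BilinForm.apply_toDual_symm_apply, ← hl]
  simp [he]

theorem aeval_restrict_apply {V : Type*} [AddCommGroup V] [Module k V] (T : End k V)
    (K : Submodule k V) (hK : ∀ x ∈ K, T x ∈ K) (p : k[X]) (x : K) :
    ((aeval (T.restrict hK) p x : K) : V) = aeval T p x := by
  induction p using Polynomial.induction_on generalizing x with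
  | C a => simp
  | add p q hp hq => simp [hp, hq]
  | monomial n a h =>
    have e : (C a * X ^ (n + 1) : k[X]) = C a * X ^ n * X := by ring
    rw [e, map_mul _ _ X, map_mul _ _ X, Module.End.mul_apply, Module.End.mul_apply, h, aeval_X,
      aeval_X]
    rfl

/-- A pair with nondegenerate first form splits off a block for the minimal polynomial of its
operator. -/
theorem exists_block {P : AltPair k} (hP : P.A.Nondegenerate) {T : End k P.V} (hT : P.IsOp T) :
    ∃ P', Block (minpoly k T) P P' ∧ P'.A.Nondegenerate ∧
      (∃ T', P'.IsOp T' ∧ minpoly k T' ∣ minpoly k T) ∧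
      P'.dim + 2 * (minpoly k T).natDegree ≤ P.dim := by
  obtain ⟨v, w, hv, hw⟩ := exists_frobenius_pair hP (T := T)
  set f := minpoly k T with hf
  have hfm : f.Monic := minpoly.monic (Algebra.IsIntegral.isIntegral T)
  let ev : P.V → k[X] →ₗ[k] P.V := fun u => (LinearMap.applyₗ u).comp (aeval T).toLinearMap
  let Ψ : (k[X] × k[X]) →ₗ[k] P.V := (ev v).coprod (ev w)
  have hΨ : ∀ x, Ψ x = aeval T x.1 v + aeval T x.2 w := fun x => rfl
  have hpq : ∀ (p q : k[X]) (u u' : P.V),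
      P.A (aeval T p u) (aeval T q u') = P.A (aeval T (p * q) u) u' := fun p q u u' => by
    rw [← hT.aeval_comm, ← Module.End.mul_apply, ← map_mul, mul_comm]
  have hΨA : ∀ x y, P.A (Ψ x) (Ψ y) = topCoeff f (x.1 * y.2 - x.2 * y.1) := fun x y => by
    rw [hΨ, hΨ]
    simp only [map_add, LinearMap.add_apply, map_sub]
    rw [← P.altA.neg_eq (aeval T y.1 v) (aeval T x.2 w), hpq, hpq, hpq, hpq, hT.aeval_self,
      hT.aeval_self, hw, hw, mul_comm y.1]
    ring
  have hTΨ : ∀ x, T (Ψ x) = Ψ (X * x.1, X * x.2) := fun x => by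
    simp [hΨ]
  have h0 : ∀ x, (∀ y, P.A (Ψ x) (Ψ y) = 0) → f ∣ x.1 ∧ f ∣ x.2 := fun x hx => by
    refine ⟨dvd_of_topCoeff hfm fun j => ?_, dvd_of_topCoeff hfm fun j => ?_⟩
    · have := hx (0, X ^ j)
      rwa [hΨA, mul_zero, sub_zero] at this
    · have := hx (X ^ j, 0)
      rwa [hΨA, mul_zero, zero_sub, map_neg, neg_eq_zero] at this
  have h0' : ∀ x, f ∣ x.1 ∧ f ∣ x.2 → Ψ x = 0 := by
    have : ∀ p, f ∣ p → aeval T p = 0 := fun p hp => (minpoly.dvd_iff).mp hp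
    rintro x ⟨h1, h2⟩
    simp [hΨ, this _ h1, this _ h2]
  have h00 : ∀ x, Ψ x = 0 ↔ f ∣ x.1 ∧ f ∣ x.2 := fun x =>
    ⟨fun hx => h0 x fun y => by simp [hx], h0' x⟩
  have hc : IsCompl (LinearMap.range Ψ) (P.A.orthogonal (LinearMap.range Ψ)) := by
    rw [LinearMap.BilinForm.isCompl_orthogonal_iff_disjoint P.altA.isRefl, Submodule.disjoint_def]
    rintro _ ⟨x, rfl⟩ hx
    refine h0' x (h0 x fun y => ?_)
    rw [← P.altA.neg_eq, neg_eq_zero]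
    exact hx _ ⟨y, rfl⟩
  set K := P.A.orthogonal (LinearMap.range Ψ) with hK
  have hTK : ∀ y ∈ K, T y ∈ K := by
    rintro y hy _ ⟨x, rfl⟩
    change P.A (Ψ x) (T y) = 0
    rw [← hT.apply_comm, hTΨ]
    exact hy _ ⟨_, rfl⟩
  refine ⟨P.sub K, ⟨Ψ, hΨA, fun x y => ?_, h00, hc, fun x y hy => ?_, rfl⟩, ?_,
    ⟨T.restrict hTK, fun (x : K) (y : K) => hT x y, ?_⟩, ?_⟩
  · rw [hT, hTΨ, hΨA]
    congr 1
    ring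
  · rw [hT, hTΨ]
    exact hy _ ⟨_, rfl⟩
  · refine (LinearMap.IsRefl.nondegenerate_iff_separatingLeft (P.sub K).altA.isRefl).mpr ?_
    intro (x : K) hx
    refine Subtype.ext (hP.1 _ fun y => ?_)
    have hy := Submodule.projection_add_projection_eq_self hc y
    have h1 : P.A ((LinearMap.range Ψ).projection _ hc y) x = 0 :=
      x.2 _ (Submodule.projection_apply_mem hc y)
    rw [← hy, map_add, ← P.altA.neg_eq, h1, neg_zero, zero_add]
    exact hx ⟨_, Submodule.projection_apply_mem hc.symm y⟩
  · refine minpoly.dvd k (T.restrict hTK) (LinearMap.ext fun x => Subtype.ext ?_)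
    rw [aeval_restrict_apply, minpoly.aeval]
    rfl
  · have h1 := dim_sub hc
    suffices h : 2 * f.natDegree ≤ finrank k (LinearMap.range Ψ) by omega
    -- Pairs of polynomials of degree below that of `f` embed into the block.
    let D := degreeLT k f.natDegree
    have : FiniteDimensional k D := (degreeLTEquiv k f.natDegree).symm.finiteDimensional
    let Θ : (D × D) →ₗ[k] LinearMap.range Ψ :=
      Ψ.rangeRestrict ∘ₗ (D.subtype.prodMap D.subtype)
    have hΘ : Function.Injective Θ := by
      rw [injective_iff_map_eq_zero]
      rintro ⟨x, y⟩ hxy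
      have h2 : Ψ (x, y) = 0 := congrArg Subtype.val hxy
      have h3 := (h00 _).mp h2
      have h4 : ∀ z : D, f ∣ z → z = 0 := fun z hz => by
        refine Subtype.ext (eq_zero_of_dvd_of_degree_lt hz ?_)
        rw [degree_eq_natDegree hfm.ne_zero]
        exact mem_degreeLT.mp z.2
      exact Prod.ext (h4 x h3.1) (h4 y h3.2)
    have h5 := LinearMap.finrank_le_finrank_of_injective hΘ
    rw [finrank_prod, (degreeLTEquiv k f.natDegree).finrank_eq, finrank_fin_fun] at h5
    omega

/-- The pair is a sum of blocks for the products of final segments of `g`. -/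
def HasChain : ∀ n : ℕ, (Fin n → k[X]) → AltPair k → Prop
  | 0, _, P => P.dim = 0
  | n + 1, g, P => ∃ P', Block (∏ i, g i) P P' ∧ HasChain n (Fin.tail g) P'

theorem HasChain.iso {n : ℕ} {g : Fin n → k[X]} {P Q : AltPair k} (hP : HasChain n g P)
    (hQ : HasChain n g Q) : P.Iso Q := by
  induction n generalizing P Q with
  | zero =>
    have h1 : finrank k P.V = 0 := hP
    have h2 : finrank k Q.V = 0 := hQ
    have : Subsingleton P.V := finrank_zero_iff.mp h1
    refine ⟨LinearEquiv.ofFinrankEq _ _ (h1.trans h2.symm), fun x y => ?_, fun x y => ?_⟩ <;>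
    · rw [Subsingleton.elim x 0]
      simp
  | succ n ih =>
    obtain ⟨P', hb, hc⟩ := hP
    obtain ⟨Q', hb', hc'⟩ := hQ
    exact hb.iso hb' (ih hc hc')

/-- Splitting off blocks gives polynomials f₀, f₁, … each divisible by the next, and `g i` is the
quotient of f_i by f_(i+1). Thus the degree of `g i` enters i + 1 of the blocks. The block of the
polynomial 1 is zero, so any `n` that bounds the dimension will do. -/
theorem exists_hasChain (n : ℕ) {P : AltPair k} (hP : P.A.Nondegenerate) {T : End k P.V}
    (hT : P.IsOp T) (hn : P.dim ≤ n) :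
    ∃ g : Fin n → k[X], HasChain n g P ∧ (∀ i, (g i).Monic) ∧ (∏ i, g i) ∣ minpoly k T ∧
      2 * ∑ i : Fin n, ((i : ℕ) + 1) * (g i).natDegree ≤ P.dim := by
  induction n generalizing P with
  | zero => exact ⟨Fin.elim0, Nat.le_zero.mp hn, fun i => i.elim0, by simp, by simp⟩
  | succ n ih =>
    obtain ⟨P', hb, hP', ⟨T', hT', hdvd⟩, hdim⟩ := exists_block hP hT
    have hfm : (minpoly k T).Monic := minpoly.monic (Algebra.IsIntegral.isIntegral T)
    have hn' : P'.dim ≤ n := by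
      by_cases h0 : P.dim = 0
      · omega
      · have : Nontrivial P.V := finrank_pos_iff.mp (Nat.pos_of_ne_zero h0)
        have := minpoly.natDegree_pos (Algebra.IsIntegral.isIntegral (R := k) T)
        omega
    obtain ⟨g, hg, hgm, hgd, hgs⟩ := ih hP' hT' hn'
    obtain ⟨g₀, hg₀⟩ := hgd.trans hdvd
    have hpm : (∏ i, g i).Monic := monic_prod_of_monic _ _ fun i _ => hgm i
    have hg₀m : g₀.Monic := by
      rw [hg₀] at hfm
      exact hpm.of_mul_monic_left hfm
    have hprod : ∏ i, (Fin.cons g₀ g : Fin (n + 1) → k[X]) i = minpoly k T := by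
      rw [Fin.prod_univ_succ, hg₀, mul_comm]
      simp
    refine ⟨Fin.cons g₀ g, ⟨P', by rwa [hprod], by rwa [Fin.tail_cons]⟩, ?_, by rw [hprod], ?_⟩
    · intro i
      refine Fin.cases ?_ (fun j => ?_) i
      · exact hg₀m
      · exact hgm j
    · have hdeg : (minpoly k T).natDegree = ∑ i, (g i).natDegree + g₀.natDegree := by
        rw [hg₀, hpm.natDegree_mul hg₀m, natDegree_prod_of_monic _ _ fun i _ => hgm i]
      have h3 : ∑ i : Fin n, (((i.succ : Fin (n + 1)) : ℕ) + 1) * (g i).natDegree =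
          ∑ i : Fin n, ((i : ℕ) + 1) * (g i).natDegree + ∑ i, (g i).natDegree := by
        rw [← Finset.sum_add_distrib]
        refine Finset.sum_congr rfl fun i _ => ?_
        rw [Fin.val_succ]
        ring
      rw [Fin.sum_univ_succ]
      simp only [Fin.cons_zero, Fin.cons_succ, Fin.val_zero, zero_add, one_mul]
      rw [h3]
      omega

end AltPair


/-! ### Counting chains of monic polynomials -/

section Counting

variable {k : Type} [Field k] [Finite k]

variable (k) in
theorem finite_monic (j : ℕ) : {f : k[X] | f.Monic ∧ f.natDegree = j}.Finite := by
  have : Finite (degreeLT k j) := Finite.of_equiv _ (degreeLTEquiv k j).symm.toEquiv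
  have : Finite {f : k[X] // f.Monic ∧ f.natDegree = j} :=
    Finite.of_equiv _ (monicEquivDegreeLT j).symm
  exact Set.finite_coe_iff.mp this

variable (k) in
/-- The monic polynomials of degree `j`. -/
noncomputable def monics (j : ℕ) : Finset k[X] := (finite_monic k j).toFinset

theorem mem_monics {j : ℕ} {f : k[X]} : f ∈ monics k j ↔ f.Monic ∧ f.natDegree = j := by
  simp [monics]

theorem card_monics (j : ℕ) : (monics k j).card = Nat.card k ^ j := by
  rw [monics, ← Set.ncard_eq_toFinset_card _ (finite_monic k j), ← Nat.card_coe_set_eq]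
  refine (Nat.card_congr ((monicEquivDegreeLT (R := k) j).trans
    (degreeLTEquiv k j).toEquiv)).trans ?_
  rw [Nat.card_fun, Nat.card_fin]

variable (k) in
/-- The monic polynomials of degree at most `m`. -/
noncomputable def monicsLE (m : ℕ) : Finset k[X] := by
  classical exact (Finset.range (m + 1)).biUnion (monics k)

theorem mem_monicsLE {m : ℕ} {f : k[X]} : f ∈ monicsLE k m ↔ f.Monic ∧ f.natDegree ≤ m := by
  simp [monicsLE, mem_monics, and_comm]

theorem sum_monicsLE (m : ℕ) (w : ℕ → ℝ) :
    ∑ f ∈ monicsLE k m, w f.natDegree = ∑ j ∈ Finset.range (m + 1), (Nat.card k : ℝ) ^ j * w j := by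
  classical
  rw [monicsLE, Finset.sum_biUnion]
  · refine Finset.sum_congr rfl fun j _ => ?_
    rw [Finset.sum_congr rfl fun f hf => by rw [(mem_monics.mp hf).2], Finset.sum_const,
      card_monics, nsmul_eq_mul]
    push_cast
    rfl
  · intro i _ j _ hij
    rw [Function.onFun, Finset.disjoint_left]
    intro f hf hf'
    exact hij ((mem_monics.mp hf).2.symm.trans (mem_monics.mp hf').2)

theorem two_le_card : (2 : ℝ) ≤ Nat.card k := by
  exact_mod_cast Finite.one_lt_card

theorem card_monicsLE_le (m : ℕ) : ((monicsLE k m).card : ℝ) ≤ 2 * (Nat.card k : ℝ) ^ m := by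
  have h := sum_monicsLE (k := k) m fun _ => 1
  simp only [Finset.sum_const, nsmul_eq_mul, mul_one] at h
  rw [h]
  have h2 := two_le_card (k := k)
  induction m with
  | zero => simp
  | succ m ih =>
    rw [Finset.sum_range_succ, pow_succ]
    have h3 := ih (by simpa using sum_monicsLE (k := k) m fun _ => 1)
    have h4 : (0 : ℝ) ≤ (Nat.card k : ℝ) ^ m := by positivity
    nlinarith

/-- One Euler factor: the series is geometric of ratio q^(-(i+1)), and q ≥ 2 makes the bound
independent of q. -/
theorem sum_monicsLE_pow_le (m i : ℕ) :
    ∑ f ∈ monicsLE k m, ((Nat.card k : ℝ)⁻¹) ^ ((i + 2) * f.natDegree) ≤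
      (1 - (1 / 2 : ℝ) ^ (i + 1))⁻¹ := by
  have h2 := two_le_card (k := k)
  set q : ℝ := (Nat.card k : ℝ)
  have hq : 0 < q := by linarith
  rw [sum_monicsLE m fun d => (q⁻¹) ^ ((i + 2) * d)]
  have hle : (q⁻¹) ^ (i + 1) ≤ (1 / 2 : ℝ) ^ (i + 1) := by
    refine pow_le_pow_left₀ (by positivity) ?_ _
    rw [one_div]
    exact inv_anti₀ (by norm_num) h2
  have hlt : (1 / 2 : ℝ) ^ (i + 1) < 1 := pow_lt_one₀ (by norm_num) (by norm_num) (by omega)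
  have hterm : ∀ j, q ^ j * (q⁻¹) ^ ((i + 2) * j) = ((q⁻¹) ^ (i + 1)) ^ j := fun j => by
    rw [← pow_mul, show (i + 2) * j = (i + 1) * j + j by ring, pow_add, inv_pow q j]
    field_simp
  calc ∑ j ∈ Finset.range (m + 1), q ^ j * (q⁻¹) ^ ((i + 2) * j)
      = ∑ j ∈ Finset.range (m + 1), ((q⁻¹) ^ (i + 1)) ^ j := Finset.sum_congr rfl fun j _ => hterm j
    _ ≤ ∑' j, ((q⁻¹) ^ (i + 1)) ^ j :=
        (summable_geometric_of_lt_one (by positivity) (hle.trans_lt hlt)).sum_le_tsum _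
          fun _ _ => by positivity
    _ = (1 - (q⁻¹) ^ (i + 1))⁻¹ :=
        tsum_geometric_of_lt_one (by positivity) (hle.trans_lt hlt)
    _ ≤ (1 - (1 / 2 : ℝ) ^ (i + 1))⁻¹ := inv_anti₀ (by linarith) (by linarith)

/-- The extra power of 1/2 on the left lets the induction close; only 1/4 is needed later. -/
theorem prod_one_sub_half_pow (n : ℕ) :
    1 / 4 + (1 / 2 : ℝ) ^ (n + 2) ≤ ∏ i : Fin (n + 1), (1 - (1 / 2 : ℝ) ^ ((i : ℕ) + 1)) := by
  induction n with
  | zero => norm_num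
  | succ n ih =>
    rw [Fin.prod_univ_castSucc]
    simp only [Fin.val_castSucc, Fin.val_last]
    have h1 : (0 : ℝ) < (1 / 2) ^ n := by positivity
    have h2 : (1 / 2 : ℝ) ^ n ≤ 1 := pow_le_one₀ (by norm_num) (by norm_num)
    have h3 : (0 : ℝ) ≤ 1 - (1 / 2 : ℝ) ^ (n + 1 + 1) := by
      have := pow_le_one₀ (n := n + 1 + 1) (by norm_num : (0 : ℝ) ≤ 1 / 2) (by norm_num)
      linarith
    refine le_trans ?_ (mul_le_mul_of_nonneg_right ih h3)
    simp only [pow_succ]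
    nlinarith

theorem prod_inv_one_sub_half_pow_le (n : ℕ) :
    ∏ i : Fin n, (1 - (1 / 2 : ℝ) ^ ((i : ℕ) + 1))⁻¹ ≤ 4 := by
  rcases n with _ | n
  · simp
  rw [Finset.prod_inv_distrib]
  have h := prod_one_sub_half_pow n
  have h1 : (0 : ℝ) < (1 / 2) ^ (n + 2) := by positivity
  rw [inv_le_comm₀ (by linarith) (by norm_num)]
  linarith

/-- The sequences of monic polynomials of weighted degree at most `m`. -/
def weightedMonics (k : Type) [Field k] (n m : ℕ) : Set (Fin n → k[X]) :=
  {g | (∀ i, (g i).Monic) ∧ ∑ i : Fin n, ((i : ℕ) + 1) * (g i).natDegree ≤ m}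

/-- The entry `g 0` carries the main term: once the tail, of weight w, is fixed, it has at most 2
q^(m-w) choices. The sum of q^(-w) over tails factors into one geometric series for each entry, with
product at most 4; hence the constant 8. -/
theorem ncard_weightedMonics_le (n m : ℕ) :
    (weightedMonics k n m).Finite ∧
      ((weightedMonics k n m).ncard : ℝ) ≤ 8 * (Nat.card k : ℝ) ^ m := by
  classical
  have h2 := two_le_card (k := k)
  set q : ℝ := (Nat.card k : ℝ) with hq
  have hq0 : 0 < q := by linarith
  have hq1 : 1 ≤ q ^ m := one_le_pow₀ (by linarith)
  rcases n with _ | n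
  · refine ⟨Set.toFinite _, ?_⟩
    have := Set.ncard_le_one_of_subsingleton (weightedMonics k 0 m)
    have h3 : ((weightedMonics k 0 m).ncard : ℝ) ≤ 1 := by exact_mod_cast this
    linarith
  let wt : (Fin n → k[X]) → ℕ := fun g => ∑ i : Fin n, ((i : ℕ) + 2) * (g i).natDegree
  let G : Finset (Fin n → k[X]) := (Fintype.piFinset fun _ => monicsLE k m).filter (wt · ≤ m)
  let Y : Finset (Σ _ : Fin n → k[X], k[X]) := G.sigma fun g => monicsLE k (m - wt g)
  let c : (Fin (n + 1) → k[X]) → Σ _ : Fin n → k[X], k[X] := fun g => ⟨Fin.tail g, g 0⟩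
  have hc : Set.InjOn c (weightedMonics k (n + 1) m) := by
    intro g _ g' _ h
    simp only [c, Sigma.mk.injEq, heq_eq_eq] at h
    rw [← Fin.cons_self_tail g, ← Fin.cons_self_tail g', h.1, h.2]
  have hmem : ∀ g ∈ weightedMonics k (n + 1) m, c g ∈ Y := by
    rintro g ⟨hg, hw⟩
    rw [Fin.sum_univ_succ] at hw
    have hw' : (g 0).natDegree + wt (Fin.tail g) ≤ m := by
      simpa [wt, Fin.tail, add_assoc] using hw
    simp only [Y, Finset.mem_sigma, G, Finset.mem_filter, Fintype.mem_piFinset, mem_monicsLE, c]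
    refine ⟨⟨fun i => ⟨hg _, ?_⟩, by omega⟩, hg 0, by omega⟩
    have h3 : ((i : ℕ) + 2) * (Fin.tail g i).natDegree ≤ wt (Fin.tail g) :=
      Finset.single_le_sum (f := fun i : Fin n => ((i : ℕ) + 2) * (Fin.tail g i).natDegree)
        (fun _ _ => Nat.zero_le _) (Finset.mem_univ i)
    nlinarith
  have hfin : (weightedMonics k (n + 1) m).Finite :=
    Set.Finite.of_injOn (t := (Y : Set _)) (fun g hg => hmem g hg) hc (Finset.finite_toSet _)
  refine ⟨hfin, ?_⟩
  have hle : (weightedMonics k (n + 1) m).ncard ≤ Y.card := by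
    rw [← Set.ncard_coe_finset]
    exact Set.ncard_le_ncard_of_injOn c (fun g hg => hmem g hg) hc (Finset.finite_toSet _)
  calc ((weightedMonics k (n + 1) m).ncard : ℝ) ≤ Y.card := by exact_mod_cast hle
    _ = ∑ g ∈ G, ((monicsLE k (m - wt g)).card : ℝ) := by
        rw [Finset.card_sigma]; push_cast; rfl
    _ ≤ ∑ g ∈ G, 2 * q ^ m * ∏ i : Fin n, (q⁻¹) ^ (((i : ℕ) + 2) * (g i).natDegree) := by
        refine Finset.sum_le_sum fun g hg => (card_monicsLE_le _).trans ?_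
        rw [Finset.prod_pow_eq_pow_sum, mul_assoc, ← hq]
        have hwm : wt g ≤ m := (Finset.mem_filter.mp hg).2
        have : q ^ m * (q⁻¹) ^ (wt g) = q ^ (m - wt g) := by
          rw [inv_pow, pow_sub₀ q hq0.ne' hwm]
        exact (congrArg (2 * ·) this).ge
    _ ≤ ∑ g ∈ Fintype.piFinset fun _ : Fin n => monicsLE k m,
          2 * q ^ m * ∏ i : Fin n, (q⁻¹) ^ (((i : ℕ) + 2) * (g i).natDegree) :=
        Finset.sum_le_sum_of_subset_of_nonneg (Finset.filter_subset _ _)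
          fun _ _ _ => by positivity
    _ = 2 * q ^ m * ∏ i : Fin n, ∑ f ∈ monicsLE k m, (q⁻¹) ^ (((i : ℕ) + 2) * f.natDegree) := by
        rw [← Finset.mul_sum, Finset.prod_univ_sum]
    _ ≤ 2 * q ^ m * ∏ i : Fin n, (1 - (1 / 2 : ℝ) ^ ((i : ℕ) + 1))⁻¹ := by
        refine mul_le_mul_of_nonneg_left (Finset.prod_le_prod (fun _ _ => by positivity)
          fun i _ => sum_monicsLE_pow_le m i) (by positivity)
    _ ≤ 2 * q ^ m * 4 :=
        mul_le_mul_of_nonneg_left (prod_inv_one_sub_half_pow_le n) (by positivity)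
    _ = 8 * q ^ m := by ring

end Counting

namespace AltPair

variable {k : Type} [Field k] [Finite k]

theorem ncard_pairs_zero_le (d : ℕ) :
    ((classes (pairs k d 0)).ncard : ℝ) ≤ 8 * √(Nat.card k) ^ d := by
  have hex : ∀ c : Quotient (setoid k), ∃ g : Fin d → k[X], c ∈ classes (pairs k d 0) →
      g ∈ weightedMonics k d (d / 2) ∧ ∃ P : AltPair k, ⟦P⟧ = c ∧ HasChain d g P := by
    intro c
    by_cases hc : c ∈ classes (pairs k d 0)
    · obtain ⟨P, ⟨hd, hr⟩, rfl⟩ := hc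
      have hn := nondegenerate_of_corank hr
      obtain ⟨T, hT⟩ := exists_isOp hn
      obtain ⟨g, hg, hgm, -, hgs⟩ := exists_hasChain d hn hT hd.le
      exact ⟨g, fun _ => ⟨⟨hgm, by omega⟩, P, rfl, hg⟩⟩
    · exact ⟨0, fun h => absurd h hc⟩
  choose F hF using hex
  obtain ⟨hfin, hcard⟩ := ncard_weightedMonics_le (k := k) d (d / 2)
  have hle : (classes (pairs k d 0)).ncard ≤ (weightedMonics k d (d / 2)).ncard := by
    refine Set.ncard_le_ncard_of_injOn F (fun c hc => (hF c hc).1) ?_ hfin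
    intro c hc c' hc' h
    obtain ⟨-, P, rfl, hP⟩ := hF c hc
    obtain ⟨-, Q, rfl, hQ⟩ := hF c' hc'
    rw [h] at hP
    exact Quotient.sound (hP.iso hQ)
  have h2 := two_le_card (k := k)
  calc ((classes (pairs k d 0)).ncard : ℝ) ≤ (weightedMonics k d (d / 2)).ncard := by
        exact_mod_cast hle
    _ ≤ 8 * (Nat.card k : ℝ) ^ (d / 2) := hcard
    _ = 8 * √(Nat.card k) ^ (2 * (d / 2)) := by rw [pow_mul, Real.sq_sqrt (by positivity)]
    _ ≤ 8 * √(Nat.card k) ^ d := by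
        refine mul_le_mul_of_nonneg_left (pow_le_pow_right₀ ?_ (Nat.mul_div_le d 2)) (by norm_num)
        rw [Real.one_le_sqrt]
        linarith

end AltPair


/-! ### The number of pairs of alternating forms -/

/-- The growth of the bound when the corank is raised to `r`. -/
noncomputable def corankFactor (r : ℕ) : ℝ := 4 * ((r : ℝ) + 1) ^ 2 * (3 / 4) ^ r

/-- The bound for pairs of corank at most `r`. -/
noncomputable def corankBound : ℕ → ℝ
  | 0 => 8
  | r + 1 => corankBound r * (1 + corankFactor (r + 1))

theorem corankFactor_nonneg (r : ℕ) : 0 ≤ corankFactor r := by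
  unfold corankFactor
  positivity

theorem corankBound_pos (r : ℕ) : 0 < corankBound r := by
  induction r with
  | zero => norm_num [corankBound]
  | succ r ih =>
    have := corankFactor_nonneg (r + 1)
    exact mul_pos ih (by linarith)

theorem corankBound_mono : Monotone corankBound := by
  refine monotone_nat_of_le_succ fun r => ?_
  have := corankFactor_nonneg (r + 1)
  exact le_mul_of_one_le_right (corankBound_pos r).le (by linarith)

/-- The bound is 8 ∏ (1 + `corankFactor` i), at most 8 times the exponential of a convergent series.
-/
theorem exists_corankBound_le : ∃ K : ℝ, 0 < K ∧ ∀ r, corankBound r ≤ K := by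
  have hs : Summable corankFactor := by
    have h (n : ℕ) : Summable fun r : ℕ => (r : ℝ) ^ n * (3 / 4 : ℝ) ^ r :=
      summable_pow_mul_geometric_of_norm_lt_one n (by norm_num)
    have := ((h 2).add ((h 1).mul_left 2)).add (h 0) |>.mul_left 4
    refine this.congr fun r => ?_
    rw [corankFactor]
    ring
  refine ⟨8 * Real.exp (∑' r, corankFactor (r + 1)), by positivity, fun r => ?_⟩
  have hs' : Summable fun r => corankFactor (r + 1) := (summable_nat_add_iff 1).mpr hs
  have h1 : corankBound r ≤ 8 * Real.exp (∑ i ∈ Finset.range r, corankFactor (i + 1)) := by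
    induction r with
    | zero => simp [corankBound]
    | succ r ih =>
      rw [Finset.sum_range_succ, Real.exp_add, ← mul_assoc]
      have := corankFactor_nonneg (r + 1)
      refine mul_le_mul ih ?_ (by linarith) (by positivity)
      have := Real.add_one_le_exp (corankFactor (r + 1))
      linarith
  refine h1.trans (mul_le_mul_of_nonneg_left (Real.exp_le_exp.mpr ?_) (by norm_num))
  exact hs'.sum_le_tsum _ fun i _ => corankFactor_nonneg _

namespace AltPair

variable {k : Type} [Field k]

/-- Covers the range in which the subtraction `d - 2 * r` of `ncard_reduced_le` would truncate and
spoil the exponent. -/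
theorem ncard_reduced_eq_zero {d r : ℕ} (h : d < 2 * r) :
    (classes (pairs k d r ∩ {P | P.Reduced})).ncard = 0 := by
  have : pairs k d r ∩ {P | P.Reduced} = ∅ := by
    rw [Set.eq_empty_iff_forall_notMem]
    rintro P ⟨⟨hd, hr⟩, hP⟩
    obtain ⟨X, hX⟩ := hP.exists_isCore
    have := hP.finrank_core hX
    omega
  simp [this, classes]

theorem ncard_pairs_eq_zero {d r : ℕ} (h : d < r) : (classes (pairs k d r)).ncard = 0 := by
  have : pairs k d r = ∅ := by
    rw [Set.eq_empty_iff_forall_notMem]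
    rintro P ⟨hd, hr⟩
    have := P.corank_le_dim
    omega
  simp [this, classes]

variable [Finite k]

/-- Induction on `d`, and on `r` inside. For corank ρ = r + 1 the reductions pass through reduced
pairs of corank ρ - a to cores of dimension d - (2ρ - a) < d, saving a factor t^(2ρ-a) ≥ t^ρ in each
of O(ρ^2) terms. Only a = 0 brings in `corankBound ρ` itself; its saving t^(2ρ) ≥ 2 lets the left
side absorb it. -/
theorem sum_ncard_pairs_le (d r : ℕ) :
    ∑ s ∈ Finset.range (r + 1), ((classes (pairs k d s)).ncard : ℝ) ≤
      corankBound r * √(Nat.card k) ^ d := by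
  induction d using Nat.strong_induction_on generalizing r with
  | _ d ihd =>
  have hq := two_le_card (k := k)
  set t : ℝ := √(Nat.card k) with ht
  have ht2 : t ^ 2 = Nat.card k := Real.sq_sqrt (by positivity)
  have ht0 : 0 < t := Real.sqrt_pos.mpr (by linarith)
  -- √2 exceeds 4/3, which is where the ratio 3/4 in `corankFactor` comes from.
  have htl : 4 / 3 ≤ t := by nlinarith
  induction r with
  | zero =>
    simpa [corankBound] using ncard_pairs_zero_le (k := k) d
  | succ r ihr =>
    rw [Finset.sum_range_succ]
    set ρ := r + 1 with hρ
    set c := corankFactor ρ with hc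
    have hS : corankBound ρ = corankBound r * (1 + c) := rfl
    have hSr := corankBound_pos r
    suffices h : ((classes (pairs k d ρ)).ncard : ℝ) ≤ c * corankBound r * t ^ d by
      rw [hS]; linarith
    rcases lt_or_ge d ρ with hd | hd
    · rw [ncard_pairs_eq_zero hd, Nat.cast_zero]
      have := corankFactor_nonneg ρ
      positivity
    set l : ℝ := t⁻¹ with hl
    have hl0 : 0 < l := inv_pos.mpr ht0
    have hl1 : l ≤ 3 / 4 := by
      rw [hl]; exact (inv_le_comm₀ ht0 (by norm_num)).mpr (by norm_num; exact htl)
    have hl2 : l ^ 2 ≤ 1 / 2 := by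
      rw [hl, inv_pow, ht2, one_div]; exact inv_anti₀ (by norm_num) hq
    have htp : ∀ a ≤ d, t ^ (d - a) = t ^ d * l ^ a := fun a ha => by
      rw [hl, inv_pow, pow_sub₀ t ht0.ne' ha]
    -- the reduced pairs of corank `ρ - a`
    have hG : ∀ a ≤ ρ, ((classes (pairs k (d - a) (ρ - a) ∩ {P | P.Reduced})).ncard : ℝ) ≤
        corankBound (ρ - a) * (t ^ d * l ^ (ρ + (ρ - a))) := by
      intro a ha
      rcases lt_or_ge (d - a) (2 * (ρ - a)) with h | h
      · rw [ncard_reduced_eq_zero h, Nat.cast_zero]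
        have := corankBound_pos (ρ - a)
        positivity
      rw [← htp _ (by omega), show d - (ρ + (ρ - a)) = d - a - 2 * (ρ - a) by omega]
      have h1 := ncard_reduced_le (k := k) (d - a) (ρ - a)
      have h2 : ((classes (pairs k (d - a) (ρ - a) ∩ {P | P.Reduced})).ncard : ℝ) ≤
          ∑ s ∈ Finset.range (ρ - a + 1),
            ((classes (pairs k (d - a - 2 * (ρ - a)) s)).ncard : ℝ) := by exact_mod_cast h1
      refine h2.trans (ihd _ ?_ _)
      omega
    set M : ℝ := t ^ d * l ^ ρ * corankBound r with hM
    have hM0 : 0 ≤ M := by positivity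
    have hG1 : ∀ a, 1 ≤ a → a ≤ ρ →
        ((classes (pairs k (d - a) (ρ - a) ∩ {P | P.Reduced})).ncard : ℝ) ≤ M := by
      intro a ha ha'
      refine (hG a ha').trans ?_
      have h1 : corankBound (ρ - a) ≤ corankBound r := corankBound_mono (by omega)
      have h2 : l ^ (ρ + (ρ - a)) ≤ l ^ ρ :=
        pow_le_pow_of_le_one hl0.le (by linarith) (by omega)
      calc corankBound (ρ - a) * (t ^ d * l ^ (ρ + (ρ - a)))
          ≤ corankBound r * (t ^ d * l ^ ρ) := by gcongr
        _ = M := by rw [hM]; ring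
    have hE : ∀ a ≤ ρ, ((classes (pairs k (d - a) (ρ - a) ∩ {P | P.IsotropicRad})).ncard : ℝ) ≤
        ∑ s ∈ Finset.range (ρ - a + 1),
          ((classes (pairs k (d - (a + s)) (ρ - (a + s)) ∩ {P | P.Reduced})).ncard : ℝ) := by
      intro a ha
      have := ncard_isotropicRad_le (k := k) (d - a) (ρ - a)
      simp only [Nat.sub_sub] at this ⊢
      exact_mod_cast this
    have hE1 : ∀ a, 1 ≤ a → a ≤ ρ →
        ((classes (pairs k (d - a) (ρ - a) ∩ {P | P.IsotropicRad})).ncard : ℝ) ≤ ρ * M := by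
      intro a ha ha'
      refine (hE a ha').trans ((Finset.sum_le_card_nsmul _ _ M fun s hs => ?_).trans ?_)
      · rw [Finset.mem_range] at hs
        exact hG1 _ (by omega) (by omega)
      · rw [Finset.card_range, nsmul_eq_mul]
        refine mul_le_mul_of_nonneg_right ?_ hM0
        exact_mod_cast (by omega : ρ - a + 1 ≤ ρ)
    have hE0 : ((classes (pairs k (d - 0) (ρ - 0) ∩ {P | P.IsotropicRad})).ncard : ℝ) ≤
        ρ * M + corankBound ρ * (t ^ d * l ^ (2 * ρ)) := by
      refine (hE 0 (Nat.zero_le _)).trans ?_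
      rw [Finset.sum_range_succ']
      refine add_le_add ((Finset.sum_le_card_nsmul _ _ M fun s hs => ?_).trans ?_) ?_
      · rw [Finset.mem_range] at hs
        exact hG1 _ (by omega) (by omega)
      · rw [Finset.card_range, nsmul_eq_mul]
        rfl
      · have := hG 0 (Nat.zero_le _)
        rwa [show ρ + (ρ - 0) = 2 * ρ by omega] at this
    have hD : ((classes (pairs k d ρ)).ncard : ℝ) ≤
        ρ * (ρ * M) + (ρ * M + corankBound ρ * (t ^ d * l ^ (2 * ρ))) := by
      have h1 : ((classes (pairs k d ρ)).ncard : ℝ) ≤ ∑ s ∈ Finset.range (ρ + 1),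
          ((classes (pairs k (d - s) (ρ - s) ∩ {P | P.IsotropicRad})).ncard : ℝ) := by
        exact_mod_cast ncard_pairs_le (k := k) d ρ
      refine h1.trans ?_
      rw [Finset.sum_range_succ']
      refine add_le_add ((Finset.sum_le_card_nsmul _ _ (ρ * M) fun s hs => ?_).trans ?_) hE0
      · rw [Finset.mem_range] at hs
        exact hE1 _ (by omega) (by omega)
      · rw [Finset.card_range, nsmul_eq_mul]
    refine hD.trans ?_
    have hρ1 : (1 : ℝ) ≤ ρ := by
      rw [hρ]; push_cast; linarith [Nat.cast_nonneg (α := ℝ) r]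
    have hlρ : l ^ ρ ≤ (3 / 4) ^ ρ := pow_le_pow_left₀ hl0.le hl1 _
    have hcl : 4 * ((ρ : ℝ) + 1) ^ 2 * l ^ ρ ≤ c := by
      rw [hc, corankFactor]
      gcongr
    have h2ρ : l ^ (2 * ρ) ≤ 1 / 2 * 1 := by
      rw [hρ, show 2 * (r + 1) = 2 + 2 * r by ring, pow_add]
      exact mul_le_mul hl2 (pow_le_one₀ hl0.le (by linarith)) (by positivity) (by norm_num)
    have h2ρ' : l ^ (2 * ρ) ≤ l ^ ρ :=
      pow_le_pow_of_le_one hl0.le (by linarith) (by omega)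
    have hc0 : 0 ≤ c := corankFactor_nonneg ρ
    have hlρ0 : 0 < l ^ ρ := by positivity
    -- The terms without `c` add up to at most (ρ + 1)^2 l^ρ ≤ c/4, and c l^(2ρ) is at most c/2.
    have key : (ρ : ℝ) * (ρ * l ^ ρ) + (ρ * l ^ ρ + (1 + c) * l ^ (2 * ρ)) ≤ c := by
      have e1 : (1 + c) * l ^ (2 * ρ) ≤ l ^ ρ + c * (1 / 2) := by nlinarith
      have e2 : (ρ : ℝ) * (ρ * l ^ ρ) + (ρ * l ^ ρ + l ^ ρ) ≤ ((ρ : ℝ) + 1) ^ 2 * l ^ ρ := by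
        nlinarith
      linarith
    have hX : 0 ≤ corankBound r * t ^ d := by positivity
    calc (ρ : ℝ) * (ρ * M) + (ρ * M + corankBound ρ * (t ^ d * l ^ (2 * ρ)))
        = ((ρ : ℝ) * (ρ * l ^ ρ) + (ρ * l ^ ρ + (1 + c) * l ^ (2 * ρ))) *
            (corankBound r * t ^ d) := by rw [hM, hS]; ring
      _ ≤ c * (corankBound r * t ^ d) := mul_le_mul_of_nonneg_right key hX
      _ = c * corankBound r * t ^ d := by ring

/-- There are `O(q ^ (d / 2))` pairs of alternating forms in dimension `d` over a field with `q`
elements. -/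
theorem exists_ncard_le : ∃ K : ℝ, 0 < K ∧ ∀ (k : Type) [Field k] [Finite k] (d : ℕ),
    ((classes {P : AltPair k | P.dim = d}).ncard : ℝ) ≤ K * √(Nat.card k) ^ d := by
  obtain ⟨K, hK, hKr⟩ := exists_corankBound_le
  refine ⟨K, hK, fun k _ _ d => ?_⟩
  have h1 : (classes {P : AltPair k | P.dim = d}).ncard ≤
      ∑ s ∈ Finset.range (d + 1), (classes (pairs k d s)).ncard := by
    refine ncard_classes_le _ _ _ (fun s => finite_classes_of_dim d fun P hP => hP.1)
      (fun _ P P' => P' = P) (fun P hP => ⟨P.corank, ?_, P, ⟨hP, rfl⟩, rfl⟩) ?_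
    · rw [Finset.mem_range, Nat.lt_succ_iff, ← show P.dim = d from hP]
      exact P.corank_le_dim
    · rintro i P - Q - _ _ rfl rfl h
      exact h
  have h2 : ((classes {P : AltPair k | P.dim = d}).ncard : ℝ) ≤
      ∑ s ∈ Finset.range (d + 1), ((classes (pairs k d s)).ncard : ℝ) := by exact_mod_cast h1
  exact (h2.trans (sum_ncard_pairs_le d d)).trans
    (mul_le_mul_of_nonneg_right (hKr d) (by positivity))

end AltPair


/-! ### From groups to pairs of alternating forms -/

section CentroidField

variable {V W : Type} [AddCommGroup V] [AddCommGroup W]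

/-- An alternating biadditive map whose centroid is a field, over which the codomain has dimension
two, is given by two alternating forms over a finite field. -/
theorem exists_altPair_of_isField_centroid [Finite V] [Finite W] (B : V →+ V →+ W)
    (halt : ∀ v, B v v = 0) (hF : IsField (centroid B)) (hr : finrank (centroid B) W = 2)
    {p n : ℕ} [hp : Fact p.Prime] (hW : Nat.card W ∣ p ^ n) :
    ∃ e, 1 ≤ e ∧ Nat.card W = (p ^ e) ^ 2 ∧ ∃ P : AltPair (GaloisField p e),
      Nat.card V = (p ^ e) ^ P.dim ∧ ∃ (φ : V ≃+ P.V) (ψ : W ≃+ (Fin 2 → GaloisField p e)),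
        ∀ u v, ψ (B u v) = ![P.A (φ u) (φ v), P.B (φ u) (φ v)] := by
  let _ : Field (centroid B) := hF.toField
  have : Finite (AddMonoid.End V) := DFunLike.finite _
  have : Finite (AddMonoid.End W) := DFunLike.finite _
  have : Finite (centroid B) := inferInstance
  have hcW : Nat.card W = Nat.card (centroid B) ^ 2 := by
    rw [← hr]
    exact Module.natCard_eq_pow_finrank
  obtain ⟨e, -, he⟩ := (Nat.dvd_prime_pow hp.out).mp
    (((Dvd.intro_left _ (pow_succ (Nat.card (centroid B)) 1).symm).trans hcW.symm.dvd).trans hW)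
  have he1 : 1 ≤ e := by
    by_contra h
    have h0 : e = 0 := by omega
    have := Finite.one_lt_card (α := centroid B)
    rw [he, h0, pow_zero] at this
    exact lt_irrefl _ this
  refine ⟨e, he1, by rw [hcW, he], ?_⟩
  have hcK : Nat.card (GaloisField p e) = p ^ e := GaloisField.card p e (by omega)
  let _ := Fintype.ofFinite (GaloisField p e)
  let _ := Fintype.ofFinite (centroid B)
  -- This identification is not canonical. Any choice serves an upper bound, which needs only that
  -- isometric pairs give isoclinic groups.
  let θ : GaloisField p e ≃+* centroid B := FiniteField.ringEquivOfCardEq (by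
    rw [Fintype.card_eq_nat_card, Fintype.card_eq_nat_card, hcK, he])
  let _ : Module (GaloisField p e) V :=
    Module.compHom V (((RingHom.fst (AddMonoid.End V) (AddMonoid.End V × AddMonoid.End W)).comp
      (centroid B).subtype).comp (θ : GaloisField p e →+* centroid B))
  let _ : Module (GaloisField p e) W := Module.compHom W (θ : GaloisField p e →+* centroid B)
  have hV (c : GaloisField p e) (v : V) : c • v = (θ c).1.1 v := rfl
  have hW (c : GaloisField p e) (w : W) : c • w = (θ c).1.2.2 w := rfl
  have hrK : finrank (GaloisField p e) W = 2 := by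
    have h1 : Nat.card W = Nat.card (GaloisField p e) ^ finrank (GaloisField p e) W :=
      Module.natCard_eq_pow_finrank
    rw [hcW, hcK, he] at h1
    exact (Nat.pow_right_injective (Nat.one_lt_pow (by omega) hp.out.one_lt) h1).symm
  have hanti : ∀ u v, B u v = -B v u := fun u v => by
    have := halt (u + v)
    simp only [map_add, AddMonoidHom.add_apply, halt, add_zero, zero_add] at this
    exact eq_neg_of_add_eq_zero_right this
  have hsl (c : GaloisField p e) (u v : V) : B (c • u) v = c • B u v := ((θ c).2 u v).1
  have hsr (c : GaloisField p e) (u v : V) : B u (c • v) = c • B u v := by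
    rw [hanti, hsl, hanti v u, smul_neg, neg_neg]
  let ω : W ≃ₗ[GaloisField p e] (Fin 2 → GaloisField p e) :=
    LinearEquiv.ofFinrankEq _ _ (by rw [hrK, finrank_fin_fun])
  let b : V →ₗ[GaloisField p e] V →ₗ[GaloisField p e] W :=
    LinearMap.mk₂ _ (fun u v => B u v) (fun u u' v => by simp) (fun c u v => hsl c u v)
      (fun u v v' => by simp) (fun c u v => hsr c u v)
  have hb : ∀ u v, b u v = B u v := fun u v => rfl
  let c : Fin 2 → LinearMap.BilinForm (GaloisField p e) V := fun i =>
    b.compr₂ (LinearMap.proj i ∘ₗ ω.toLinearMap)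
  have hc : ∀ i u v, c i u v = ω (B u v) i := fun i u v => rfl
  have hcalt : ∀ i, (c i).IsAlt := fun i v => by rw [hc, halt, map_zero, Pi.zero_apply]
  have : FiniteDimensional (GaloisField p e) V := inferInstance
  refine ⟨⟨V, c 0, c 1, hcalt 0, hcalt 1⟩, ?_, AddEquiv.refl V, ω.toAddEquiv, fun u v => ?_⟩
  · rw [← hcK]
    exact Module.natCard_eq_pow_finrank
  · ext i
    fin_cases i <;> rfl

end CentroidField

section Groups

open Subgroup

theorem commutationMap_self {G : Type*} [Group G] (a : G ⧸ center G) :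
    commutationMap G a a = 1 := by
  induction a using QuotientGroup.induction_on with | _ x
  exact Subtype.ext (commutatorElement_self x)

/-- The commutation map of `G` is, up to isomorphisms, the map `β`. -/
def HasCommutationMap (G : Type*) [Group G] {V W : Type*} [AddCommGroup V] [AddCommGroup W]
    (β : V → V → W) : Prop :=
  ∃ (φ : G ⧸ center G ≃* Multiplicative V) (ψ : commutator G ≃* Multiplicative W),
    ∀ a b, ψ (commutationMap G a b) = Multiplicative.ofAdd (β (φ a).toAdd (φ b).toAdd)

/-- `G` has the commutation map given by the two forms of `P`. -/
def CommutationPair (G : Type) [Group G] {k : Type} [Field k] (P : AltPair k) : Prop :=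
  HasCommutationMap G fun u v => ![P.A u v, P.B u v]

theorem CommutationPair.isoclinic {G H : Type} [Group G] [Group H] {k : Type} [Field k]
    {P Q : AltPair k} (hG : CommutationPair G P) (hH : CommutationPair H Q) (h : P.Iso Q) :
    Isoclinic G H := by
  obtain ⟨φ, ψ, hφ⟩ := hG
  obtain ⟨φ', ψ', hφ'⟩ := hH
  obtain ⟨f, hA, hB⟩ := h
  refine ⟨(φ.trans (AddEquiv.toMultiplicative f.toAddEquiv)).trans φ'.symm, ψ.trans ψ'.symm,
    fun a b => ?_⟩
  apply ψ'.injective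
  rw [hφ']
  simp only [MulEquiv.trans_apply, MulEquiv.apply_symm_apply, hφ]
  congr 1
  change ![Q.A (f (φ a).toAdd) (f (φ b).toAdd), Q.B (f (φ a).toAdd) (f (φ b).toAdd)] = _
  rw [hA, hB]

theorem HasGenusOverField.exists_commutationPair {G : Type} [Group G] {p n : ℕ}
    [hp : Fact p.Prime] (hG : Nat.card G = p ^ n) (h : HasGenusOverField G 2) :
    ∃ e d, 1 ≤ e ∧ e * (d + 2) ≤ n ∧
      ∃ P : AltPair (GaloisField p e), P.dim = d ∧ CommutationPair G P := by
  obtain ⟨hc, hF, hr⟩ := h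
  have hfin : Finite G := Nat.finite_of_card_ne_zero (by
    rw [hG]; exact pow_ne_zero _ hp.out.ne_zero)
  have : Finite (Additive (G ⧸ center G)) := inferInstanceAs (Finite (G ⧸ center G))
  have : Finite (Additive (commutator G)) := inferInstanceAs (Finite (commutator G))
  have hWG : Nat.card (Additive (commutator G)) ∣ p ^ n := by
    rw [← hG]
    exact card_subgroup_dvd_card (commutator G)
  obtain ⟨e, he, hW, P, hV, φ, ψ, hφ⟩ := exists_altPair_of_isField_centroid
    (commutationBimap G) (fun v => congrArg Additive.ofMul (commutationMap_self v.toMul)) hF hr hWG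
  refine ⟨e, P.dim, he, ?_, P, rfl, AddEquiv.toMultiplicativeRight φ,
    AddEquiv.toMultiplicativeRight ψ, fun a b => congrArg Multiplicative.ofAdd (hφ a b)⟩
  have h1 := card_eq_card_quotient_mul_card_subgroup (center G)
  have h2 : Nat.card (commutator G) ∣ Nat.card (center G) :=
    card_dvd_of_le hc.commutator_le_center
  have h3 : (p ^ e) ^ P.dim * (p ^ e) ^ 2 ∣ p ^ n := by
    rw [← hV, ← hW, ← hG, h1]
    exact mul_dvd_mul_left _ h2
  rw [← pow_add, ← pow_mul] at h3
  exact (Nat.pow_dvd_pow_iff_le_right hp.out.one_lt).mp h3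

end Groups

/-! ### The upper bound -/

/-- The pairs `(e, d)` with `1 ≤ e` and `e * (d + 2) ≤ n`. -/
def degreeDims (n : ℕ) : Finset (Σ _ : ℕ, ℕ) :=
  (Finset.Icc 1 n).sigma fun e => Finset.range (n / e - 1)

theorem mem_degreeDims {n e d : ℕ} (he : 1 ≤ e) (h : e * (d + 2) ≤ n) :
    (⟨e, d⟩ : Σ _ : ℕ, ℕ) ∈ degreeDims n := by
  have h1 : d + 2 ≤ n / e := (Nat.le_div_iff_mul_le he).mpr (by rwa [mul_comm])
  have h2 : e ≤ n := le_trans (Nat.le_mul_of_pos_right e (by omega)) h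
  simp only [degreeDims, Finset.mem_sigma, Finset.mem_Icc, Finset.mem_range]
  omega

/-- A group is coded by e, d and the isometry class of one pair chosen for it; equal codes force
isoclinism. -/
theorem numGenusTwo_le_sum {p : ℕ} [hp : Fact p.Prime] (n : ℕ) :
    numGenusTwo (p ^ n) ≤ ∑ x ∈ degreeDims n,
      (AltPair.classes {P : AltPair (GaloisField p x.1) | P.dim = x.2}).ncard := by
  have hex (G : GenusTwoGroup (p ^ n)) := @HasGenusOverField.exists_commutationPair
    (Fin (p ^ n)) G.1 p n hp (Nat.card_fin _) G.2
  choose e d he hed P hPd hP using hex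
  let X : (Σ _ : ℕ, ℕ) → Type 1 := fun x =>
    AltPair.classes {P : AltPair (GaloisField p x.1) | P.dim = x.2}
  have hX : ∀ x, Finite (X x) := fun x => Set.finite_coe_iff.mpr (AltPair.finite_classes_dim x.2)
  let code : GenusTwoGroup (p ^ n) → Σ x : degreeDims n, X x.1 := fun G =>
    ⟨⟨⟨e G, d G⟩, mem_degreeDims (he G) (hed G)⟩, ⟨⟦P G⟧, P G, hPd G, rfl⟩⟩
  have hcode : ∀ G H, code G = code H → @Isoclinic (Fin (p ^ n)) (Fin (p ^ n)) G.1 H.1 := by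
    intro G H h
    -- The isometry classes live over fields that depend on `(e, d)`; with both indices generalised,
    -- their equality can be substituted.
    have key : ∀ (x : Σ _ : ℕ, ℕ) (c : X x) (y : Σ _ : ℕ, ℕ) (c' : X y), x = y → HEq c c' →
        ∀ (Q : AltPair (GaloisField p x.1)) (R : AltPair (GaloisField p y.1)),
          c.1 = ⟦Q⟧ → c'.1 = ⟦R⟧ → @CommutationPair (Fin (p ^ n)) G.1 _ _ Q →
          @CommutationPair (Fin (p ^ n)) H.1 _ _ R →
          @Isoclinic (Fin (p ^ n)) (Fin (p ^ n)) G.1 H.1 := by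
      rintro x c _ c' rfl hcc Q R hQ hR hG hH
      rw [heq_eq_eq] at hcc
      subst hcc
      exact @CommutationPair.isoclinic _ _ G.1 H.1 _ _ _ _ hG hH
        (Quotient.exact (hQ.symm.trans hR))
    simp only [code, Sigma.mk.injEq, Subtype.mk.injEq] at h
    refine key ⟨e G, d G⟩ ⟨⟦P G⟧, P G, hPd G, rfl⟩ ⟨e H, d H⟩ ⟨⟦P H⟧, P H, hPd H, rfl⟩ ?_ h.2
      (P G) (P H) rfl rfl (hP G) (hP H)
    simpa using h.1
  have hinj : Function.Injective fun q : Quotient (isoclinismSetoid (p ^ n)) => code q.out := by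
    intro q q' h
    rw [← q.out_eq, ← q'.out_eq]
    exact Quotient.sound (hcode _ _ h)
  have h1 := Nat.card_le_card_of_injective _ hinj
  rw [Nat.card_sigma] at h1
  refine h1.trans (le_of_eq ?_)
  rw [← Finset.sum_coe_sort (degreeDims n)]
  rfl

/-- With u = ⌊n/e⌋ - 2 - d one has ed ≤ n - 2e - u. Summing over u costs at most 1/(1 - 3/4) = 4,
and summing over e at most 1/(1 - 1/2) = 2. -/
theorem sum_degreeDims_le (n : ℕ) {s : ℝ} (hs : 2 ≤ s ^ 2) (hs0 : 0 < s) :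
    ∑ x ∈ degreeDims n, s ^ (x.1 * x.2) ≤ 8 * s ^ n := by
  have hs1 : 4 / 3 ≤ s := by nlinarith
  set x : ℝ := s⁻¹ with hx
  have hx0 : 0 < x := inv_pos.mpr hs0
  have hx1 : x ≤ 3 / 4 := by
    rw [hx]; exact (inv_le_comm₀ hs0 (by norm_num)).mpr (by norm_num; exact hs1)
  have hx2 : x ^ 2 ≤ 1 / 2 := by
    rw [hx, inv_pow, one_div]; exact inv_anti₀ (by norm_num) hs
  have hgeom : ∀ {y : ℝ}, 0 ≤ y → y < 1 → ∀ m, ∑ i ∈ Finset.range m, y ^ i ≤ (1 - y)⁻¹ :=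
    fun h0 h1 m => by
      rw [← tsum_geometric_of_lt_one h0 h1]
      exact (summable_geometric_of_lt_one h0 h1).sum_le_tsum _ fun _ _ => by positivity
  rw [degreeDims, Finset.sum_sigma]
  have hin : ∀ e ∈ Finset.Icc 1 n, ∑ d ∈ Finset.range (n / e - 1), s ^ (e * d) ≤
      s ^ n * (x ^ 2) ^ e * 4 := by
    intro e he
    rw [Finset.mem_Icc] at he
    have hterm : ∀ d ∈ Finset.range (n / e - 1),
        s ^ (e * d) ≤ s ^ n * (x ^ 2) ^ e * x ^ (n / e - 1 - 1 - d) := by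
      intro d hd
      rw [Finset.mem_range] at hd
      set u := n / e - 1 - 1 - d with hu
      have h1 : e * (n / e) ≤ n := Nat.mul_div_le n e
      have h2 : n / e = d + 2 + u := by omega
      rw [h2] at h1
      have h3 : e * d + (2 * e + u) ≤ n := by nlinarith
      rw [mul_assoc, ← pow_mul, ← pow_add]
      have h4 : s ^ (e * d) * s ^ (2 * e + u) ≤ s ^ n := by
        rw [← pow_add]
        exact pow_le_pow_right₀ (by linarith) h3
      rw [hx, inv_pow, ← div_eq_mul_inv, le_div_iff₀ (by positivity)]
      exact h4
    refine (Finset.sum_le_sum hterm).trans ?_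
    rw [← Finset.mul_sum, Finset.sum_range_reflect (fun i => x ^ i)]
    refine mul_le_mul_of_nonneg_left ((hgeom hx0.le (by linarith) _).trans ?_) (by positivity)
    exact (inv_le_comm₀ (by linarith) (by norm_num)).mpr (by norm_num; linarith)
  refine (Finset.sum_le_sum hin).trans ?_
  rw [← Finset.sum_mul, ← Finset.mul_sum]
  have hout : ∑ e ∈ Finset.Icc 1 n, (x ^ 2) ^ e ≤ 2 := by
    have h1 : ∑ e ∈ Finset.Icc 1 n, (x ^ 2) ^ e ≤ ∑ e ∈ Finset.range (n + 1), (x ^ 2) ^ e := by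
      refine Finset.sum_le_sum_of_subset_of_nonneg (fun e he => ?_) fun _ _ _ => by positivity
      rw [Finset.mem_Icc] at he
      rw [Finset.mem_range]
      omega
    refine h1.trans ((hgeom (by positivity) (by linarith) _).trans ?_)
    exact (inv_le_comm₀ (by linarith) (by norm_num)).mpr (by norm_num; linarith)
  have : 0 < s ^ n := by positivity
  nlinarith

theorem exists_numGenusTwo_le : ∃ b : ℝ, ∀ p : ℕ, p.Prime → ∀ n : ℕ,
    (numGenusTwo (p ^ n) : ℝ) ≤ (p : ℝ) ^ ((n : ℝ) / 2 + b) := by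
  obtain ⟨K, hK, hKd⟩ := AltPair.exists_ncard_le
  -- With this b, 8K ≤ 2^b ≤ p^b; the second inequality needs b ≥ 0.
  refine ⟨max 0 (Real.logb 2 (8 * K)), fun p hp n => ?_⟩
  have : Fact p.Prime := ⟨hp⟩
  have hp2 : (2 : ℝ) ≤ p := by exact_mod_cast hp.two_le
  have hp0 : (0 : ℝ) < p := by linarith
  have hs2 : √(p : ℝ) ^ 2 = p := Real.sq_sqrt hp0.le
  have h1 : (numGenusTwo (p ^ n) : ℝ) ≤ ∑ x ∈ degreeDims n,
      ((AltPair.classes {P : AltPair (GaloisField p x.1) | P.dim = x.2}).ncard : ℝ) := by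
    exact_mod_cast numGenusTwo_le_sum (p := p) n
  have h2 : ∀ x ∈ degreeDims n,
      ((AltPair.classes {P : AltPair (GaloisField p x.1) | P.dim = x.2}).ncard : ℝ) ≤
        K * √(p : ℝ) ^ (x.1 * x.2) := by
    rintro ⟨e, d⟩ hx
    simp only [degreeDims, Finset.mem_sigma, Finset.mem_Icc] at hx
    refine (hKd (GaloisField p e) d).trans (le_of_eq ?_)
    have hsq : √((p : ℝ) ^ e) = √(p : ℝ) ^ e := by
      rw [← Real.sqrt_sq (pow_nonneg (Real.sqrt_nonneg (p : ℝ)) e), ← pow_mul, mul_comm, pow_mul,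
        hs2]
    rw [GaloisField.card p e (by omega), Nat.cast_pow, hsq, ← pow_mul]
  have h3 : (numGenusTwo (p ^ n) : ℝ) ≤ 8 * K * √(p : ℝ) ^ n := by
    refine (h1.trans (Finset.sum_le_sum h2)).trans ?_
    rw [← Finset.mul_sum]
    have := sum_degreeDims_le n (s := √(p : ℝ)) (by rw [hs2]; exact hp2) (Real.sqrt_pos.mpr hp0)
    nlinarith
  have h4 : √(p : ℝ) ^ n = (p : ℝ) ^ ((n : ℝ) / 2) := by
    rw [Real.sqrt_eq_rpow, ← Real.rpow_natCast, ← Real.rpow_mul hp0.le]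
    congr 1
    ring
  have h5 : 8 * K ≤ (p : ℝ) ^ max 0 (Real.logb 2 (8 * K)) := by
    calc 8 * K = (2 : ℝ) ^ Real.logb 2 (8 * K) :=
          (Real.rpow_logb (by norm_num) (by norm_num) (by positivity)).symm
      _ ≤ (2 : ℝ) ^ max 0 (Real.logb 2 (8 * K)) :=
          Real.rpow_le_rpow_of_exponent_le (by norm_num) (le_max_right _ _)
      _ ≤ (p : ℝ) ^ max 0 (Real.logb 2 (8 * K)) :=
          Real.rpow_le_rpow (by norm_num) hp2 (le_max_left _ _)
  rw [Real.rpow_add hp0, mul_comm, ← h4]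
  exact h3.trans (mul_le_mul_of_nonneg_right h5 (by positivity))

open scoped commutatorElement

/-! ### Groups with a given commutation map -/

section Extensions

open Subgroup

variable {V W : Type} [AddCommGroup V] [AddCommGroup W]

/-- The central extension of `V` by `W × C` with the cocycle `b` in `W`. -/
structure CentralExt (b : V →+ V →+ W) (C : Type) where
  v : V
  w : W
  c : C

namespace CentralExt

variable {b : V →+ V →+ W} {C : Type} [AddCommGroup C]

instance : Mul (CentralExt b C) := ⟨fun x y => ⟨x.v + y.v, x.w + y.w + b x.v y.v, x.c + y.c⟩⟩
instance : One (CentralExt b C) := ⟨⟨0, 0, 0⟩⟩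
instance : Inv (CentralExt b C) := ⟨fun x => ⟨-x.v, -x.w + b x.v x.v, -x.c⟩⟩

theorem mul_def (x y : CentralExt b C) :
    x * y = ⟨x.v + y.v, x.w + y.w + b x.v y.v, x.c + y.c⟩ := rfl
theorem one_def : (1 : CentralExt b C) = ⟨0, 0, 0⟩ := rfl
theorem inv_def (x : CentralExt b C) : x⁻¹ = ⟨-x.v, -x.w + b x.v x.v, -x.c⟩ := rfl

instance : Group (CentralExt b C) :=
  Group.ofLeftAxioms
    (fun x y z => by
      simp only [mul_def, map_add, AddMonoidHom.add_apply, CentralExt.mk.injEq]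
      refine ⟨add_assoc _ _ _, ?_, add_assoc _ _ _⟩
      abel)
    (fun x => by simp [mul_def, one_def])
    (fun x => by simp [mul_def, one_def, inv_def])

theorem commutatorElement_eq (x y : CentralExt b C) :
    ⁅x, y⁆ = ⟨0, b x.v y.v - b y.v x.v, 0⟩ := by
  have h : ⁅x, y⁆ * (y * x) = x * y := by
    rw [commutatorElement_def]
    group
  rw [← mul_left_inj (y * x), h]
  simp only [mul_def, map_zero, AddMonoidHom.zero_apply, CentralExt.mk.injEq]
  refine ⟨by abel, by abel, by abel⟩

/-- The underlying set of the central extension. -/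
def equivProd : CentralExt b C ≃ V × W × C where
  toFun x := (x.v, x.w, x.c)
  invFun x := ⟨x.1, x.2.1, x.2.2⟩
  left_inv _ := rfl
  right_inv _ := rfl

end CentralExt

/-- `G` maps onto `V` and contains `W` so that its commutators are given by `β`. -/
def CommutatorsGivenBy (G : Type) [Group G] (β : V → V → W) : Prop :=
  ∃ (π : G →* Multiplicative V) (ι : Multiplicative W →* G), Function.Surjective π ∧
    Function.Injective ι ∧
    ∀ x y, ⁅x, y⁆ = ι (Multiplicative.ofAdd (β (π x).toAdd (π y).toAdd))

theorem CentralExt.commutatorsGivenBy (b : V →+ V →+ W) (C : Type) [AddCommGroup C] :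
    CommutatorsGivenBy (CentralExt b C) fun u v => b u v - b v u := by
  refine ⟨⟨⟨fun x => Multiplicative.ofAdd x.v, rfl⟩, fun _ _ => rfl⟩,
    ⟨⟨fun w => ⟨0, w.toAdd, 0⟩, rfl⟩, fun w w' => ?_⟩, ?_, ?_, ?_⟩
  · simp [CentralExt.mul_def]
  · exact fun v => ⟨⟨v.toAdd, 0, 0⟩, rfl⟩
  · intro w w' h
    simpa using congrArg CentralExt.w h
  · exact fun x y => CentralExt.commutatorElement_eq x y

theorem CommutatorsGivenBy.congr {G H : Type} [Group G] [Group H] {β : V → V → W}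
    (h : CommutatorsGivenBy G β) (e : G ≃* H) : CommutatorsGivenBy H β := by
  obtain ⟨π, ι, hπ, hι, hc⟩ := h
  refine ⟨π.comp e.symm.toMonoidHom, e.toMonoidHom.comp ι, hπ.comp e.symm.surjective,
    e.injective.comp hι, fun x y => ?_⟩
  have := congrArg e (hc (e.symm x) (e.symm y))
  rw [map_commutatorElement, e.apply_symm_apply, e.apply_symm_apply] at this
  exact this

/-- Nondegeneracy makes the centre the kernel of `π`. As every element of `W` is a value of `β`, the
commutator subgroup is the range of `ι`. -/
theorem CommutatorsGivenBy.hasCommutationMap {G : Type} [Group G] {β : V →+ V →+ W}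
    (h : CommutatorsGivenBy G fun u v => β u v) (hn : ∀ u, (∀ v, β u v = 0) → u = 0)
    (hs : ∀ w, ∃ u v, β u v = w) : HasCommutationMap G fun u v => β u v := by
  obtain ⟨π, ι, hπ, hι, hc⟩ := h
  have hcenter : center G = π.ker := by
    ext x
    rw [mem_center_iff, MonoidHom.mem_ker]
    have hcomm : ∀ y, y * x = x * y ↔ β (π x).toAdd (π y).toAdd = 0 := fun y => by
      rw [eq_comm, ← commutatorElement_eq_one_iff_mul_comm, hc, ← map_one ι, hι.eq_iff]
      rfl
    simp only [hcomm]
    refine ⟨fun h => ?_, fun h y => ?_⟩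
    · refine congrArg Multiplicative.ofAdd (hn (π x).toAdd fun v => ?_)
      obtain ⟨y, hy⟩ := hπ (Multiplicative.ofAdd v)
      have := h y
      rwa [hy] at this
    · rw [h, toAdd_one, map_zero, AddMonoidHom.zero_apply]
  have hrange : commutator G = ι.range := by
    apply le_antisymm
    · rw [commutator_def, commutator_le]
      exact fun x _ y _ => ⟨_, (hc x y).symm⟩
    · rintro _ ⟨w, rfl⟩
      obtain ⟨u, v, huv⟩ := hs w.toAdd
      obtain ⟨x, hx⟩ := hπ (Multiplicative.ofAdd u)
      obtain ⟨y, hy⟩ := hπ (Multiplicative.ofAdd v)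
      have h1 := hc x y
      rw [hx, hy] at h1
      have h2 : ι w = ⁅x, y⁆ := by
        rw [h1]
        exact congrArg ι huv.symm
      rw [h2]
      exact commutator_mem_commutator (mem_top x) (mem_top y)
  refine ⟨(QuotientGroup.quotientMulEquivOfEq hcenter).trans
    (QuotientGroup.quotientKerEquivOfSurjective π hπ),
    (MulEquiv.subgroupCongr hrange).trans (MonoidHom.ofInjective hι).symm, fun a b => ?_⟩
  induction a using QuotientGroup.induction_on with | _ x
  induction b using QuotientGroup.induction_on with | _ y
  rw [MulEquiv.trans_apply, MulEquiv.symm_apply_eq]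
  exact Subtype.ext (hc x y)

theorem HasCommutationMap.exists_equiv_of_isoclinic {G H : Type} [Group G] [Group H]
    {V' W' : Type} [AddCommGroup V'] [AddCommGroup W'] {β : V → V → W} {β' : V' → V' → W'}
    (hG : HasCommutationMap G β) (hH : HasCommutationMap H β') (h : Isoclinic G H) :
    ∃ (φ : V ≃+ V') (ψ : W ≃+ W'), ∀ u v, β' (φ u) (φ v) = ψ (β u v) := by
  obtain ⟨f, g, hfg⟩ := hG
  obtain ⟨f', g', hfg'⟩ := hH
  obtain ⟨a, b, hab⟩ := h
  refine ⟨AddEquiv.toMultiplicative.symm ((f.symm.trans a).trans f'),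
    AddEquiv.toMultiplicative.symm ((g.symm.trans b).trans g'), fun u v => ?_⟩
  have h1 := hfg' (a (f.symm (Multiplicative.ofAdd u))) (a (f.symm (Multiplicative.ofAdd v)))
  have h2 := hfg (f.symm (Multiplicative.ofAdd u)) (f.symm (Multiplicative.ofAdd v))
  rw [hab] at h1
  rw [f.apply_symm_apply, f.apply_symm_apply, ← MulEquiv.eq_symm_apply] at h2
  rw [h2] at h1
  exact (congrArg Multiplicative.toAdd h1).symm

end Extensions

/-! ### Genus two from a centroid that consists of scalars -/

section GenusTwo

open Subgroup

variable {V W : Type} [AddCommGroup V] [AddCommGroup W] {p : ℕ} [hp : Fact p.Prime]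
  [Module (ZMod p) V] [Module (ZMod p) W]

/-- The third component determines an element of the centroid: nondegeneracy recovers the first
component, and antisymmetry the second. So the centroid is the image of `ZMod p`. -/
theorem isField_and_card_of_scalars (B : V →+ V →+ W) (hn : ∀ u, (∀ v, B u v = 0) → u = 0)
    (halt : ∀ v, B v v = 0) [Nontrivial W]
    (hscal : ∀ (σ : V →+ V) (τ : W →+ W), (∀ u v, B (σ u) v = τ (B u v)) →
      ∃ c : ZMod p, ∀ w, τ w = c • w) :
    IsField (centroid B) ∧ Nat.card (centroid B) = p := by
  have hanti : ∀ u v, B u v = -B v u := fun u v => by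
    have := halt (u + v)
    simp only [map_add, AddMonoidHom.add_apply, halt, add_zero, zero_add] at this
    exact eq_neg_of_add_eq_zero_right this
  have hnt : Nontrivial (centroid B) := by
    refine ⟨0, 1, fun h => ?_⟩
    obtain ⟨w, hw⟩ := exists_ne (0 : W)
    exact hw (DFunLike.congr_fun (congrArg (fun σ : centroid B => σ.1.2.2) h) w).symm
  have hcast : ∀ m : ℕ, ((m : centroid B) : AddMonoid.End V × AddMonoid.End V × AddMonoid.End W) =
      (m : AddMonoid.End V × AddMonoid.End V × AddMonoid.End W) := fun m => by simp
  have hsm {M : Type} [AddCommGroup M] (m : ℕ) (x : M) : (m : AddMonoid.End M) x = m • x := by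
    simp
  have hp0 {M : Type} [AddCommGroup M] [Module (ZMod p) M] (x : M) : p • x = 0 := by
    rw [← Nat.cast_smul_eq_nsmul (ZMod p), CharP.cast_eq_zero, zero_smul]
  have hchar : CharP (centroid B) p := by
    refine (CharP.charP_iff_prime_eq_zero hp.out).mpr (Subtype.ext ?_)
    rw [hcast]
    refine Prod.ext (AddMonoidHom.ext fun v => ?_)
      (Prod.ext (AddMonoidHom.ext fun v => ?_) (AddMonoidHom.ext fun w => ?_))
    · exact (hsm p v).trans (hp0 v)
    · exact (hsm p v).trans (hp0 v)
    · exact (hsm p w).trans (hp0 w)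
  let θ := ZMod.castHom (dvd_refl p) (centroid B)
  have hθ : Function.Bijective θ := by
    refine ⟨θ.injective, fun σ => ?_⟩
    obtain ⟨c, hc⟩ := hscal σ.1.1 σ.1.2.2 fun u v => (σ.2 u v).1
    have hval {M : Type} [AddCommGroup M] [Module (ZMod p) M] (x : M) : c.val • x = c • x := by
      rw [← Nat.cast_smul_eq_nsmul (ZMod p), ZMod.natCast_zmod_val]
    have hw : ∀ w, σ.1.2.2 w = c.val • w := fun w => (hc w).trans (hval w).symm
    have h1 : ∀ u, σ.1.1 u = c.val • u := fun u => by
      rw [← sub_eq_zero]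
      refine hn _ fun v => ?_
      rw [map_sub, AddMonoidHom.sub_apply, (σ.2 u v).1, hw, map_nsmul, AddMonoidHom.nsmul_apply, sub_self]
    have h2 : ∀ u, σ.1.2.1 u = c.val • u := fun u => by
      rw [← sub_eq_zero]
      refine hn _ fun v => ?_
      rw [hanti, map_sub, (σ.2 v u).2, hw, map_nsmul, sub_self, neg_zero]
    refine ⟨c, ?_⟩
    have h3 : θ c = (c.val : centroid B) := by
      conv_lhs => rw [← ZMod.natCast_zmod_val c]
      exact map_natCast θ _
    rw [h3]
    refine Subtype.ext ?_
    rw [hcast]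
    refine Prod.ext (AddMonoidHom.ext fun v => ?_)
      (Prod.ext (AddMonoidHom.ext fun v => ?_) (AddMonoidHom.ext fun w => ?_))
    · exact (hsm _ v).trans (h1 v).symm
    · exact (hsm _ v).trans (h2 v).symm
    · exact (hsm _ w).trans ((hval w).trans (hc w).symm)
  let e : ZMod p ≃+* centroid B := RingEquiv.ofBijective θ hθ
  exact ⟨e.symm.toMulEquiv.isField (Field.toIsField (ZMod p)),
    (Nat.card_congr e.toEquiv).symm.trans (Nat.card_zmod p)⟩

/-- A group whose commutation map has only scalars in its centroid has genus two over a field if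
its commutator subgroup has order `p ^ 2`. -/
theorem HasCommutationMap.hasGenusOverField {G : Type} [Group G] {β : V →+ V →+ W}
    (h : HasCommutationMap G fun u v => β u v) (hn : ∀ u, (∀ v, β u v = 0) → u = 0)
    (hcard : Nat.card W = p ^ 2)
    (hscal : ∀ (σ : V →+ V) (τ : W →+ W), (∀ u v, β (σ u) v = τ (β u v)) →
      ∃ c : ZMod p, ∀ w, τ w = c • w) : HasGenusOverField G 2 := by
  obtain ⟨f, g, hfg⟩ := h
  have hclass : IsClassTwo G := by
    refine ⟨?_⟩
    rw [commutator_def, commutator_le]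
    intro x _ y _
    rw [← QuotientGroup.eq_one_iff, ← MulEquiv.map_eq_one_iff f]
    change f ((QuotientGroup.mk' (center G)) ⁅x, y⁆) = 1
    rw [map_commutatorElement, map_commutatorElement, commutatorElement_eq_one_iff_mul_comm,
      mul_comm]
  let F : Additive (G ⧸ center G) ≃+ V := AddEquiv.toMultiplicativeRight.symm f
  let g' : Additive (commutator G) ≃+ W := AddEquiv.toMultiplicativeRight.symm g
  have hFg : ∀ a b, g' (commutationBimap G a b) = β (F a) (F b) := fun a b => hfg a.toMul b.toMul
  let _ : Module (ZMod p) (Additive (G ⧸ center G)) := F.module (ZMod p)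
  let _ : Module (ZMod p) (Additive (commutator G)) := g'.module (ZMod p)
  have hg's : ∀ (c : ZMod p) w, g' (c • w) = c • g' w := fun c w => g'.apply_symm_apply _
  have hcW : Nat.card (Additive (commutator G)) = p ^ 2 := by rw [Nat.card_congr g'.toEquiv, hcard]
  have hfin : Finite (Additive (commutator G)) := Nat.finite_of_card_ne_zero (by
    rw [hcW]; exact pow_ne_zero _ hp.out.ne_zero)
  have hnt : Nontrivial (Additive (commutator G)) := by
    rw [← Finite.one_lt_card_iff_nontrivial, hcW]
    exact Nat.one_lt_pow (by norm_num) hp.out.one_lt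
  obtain ⟨hF, hcC⟩ := isField_and_card_of_scalars (p := p) (commutationBimap G)
    (fun u hu => by
      rw [← map_eq_zero_iff F F.injective]
      refine hn _ fun v => ?_
      rw [← F.apply_symm_apply v, ← hFg, hu, map_zero])
    (fun v => congrArg Additive.ofMul (commutationMap_self v.toMul))
    (fun σ τ hστ => by
      obtain ⟨c, hc⟩ := hscal ((F.toAddMonoidHom.comp σ).comp F.symm.toAddMonoidHom)
        ((g'.toAddMonoidHom.comp τ).comp g'.symm.toAddMonoidHom) (fun u v => by
          have h1 := congrArg g' (hστ (F.symm u) (F.symm v))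
          rw [hFg, F.apply_symm_apply] at h1
          have h2 : commutationBimap G (F.symm u) (F.symm v) = g'.symm (β u v) := by
            rw [AddEquiv.eq_symm_apply, hFg, F.apply_symm_apply, F.apply_symm_apply]
          rw [h2] at h1
          exact h1)
      refine ⟨c, fun w => ?_⟩
      have h1 := hc (g' w)
      apply g'.injective
      rw [hg's, ← h1]
      simp)
  refine ⟨hclass, hF, ?_⟩
  let _ : Field (centroid (commutationBimap G)) := hF.toField
  have h1 : Nat.card (Additive (commutator G)) = Nat.card (centroid (commutationBimap G)) ^
      finrank (centroid (commutationBimap G)) (Additive (commutator G)) :=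
    Module.natCard_eq_pow_finrank
  rw [hcC, hcW] at h1
  exact (Nat.pow_right_injective hp.out.two_le h1).symm

/-- An alternating biadditive map with only scalars in its centroid is the commutation map of a
group of genus two over a field, of any order that is large enough. -/
theorem exists_genusTwoGroup (b β : V →+ V →+ W) (hb : ∀ u v, β u v = b u v - b v u)
    (hn : ∀ u, (∀ v, β u v = 0) → u = 0) (hs : ∀ w, ∃ u v, β u v = w)
    (hscal : ∀ (σ : V →+ V) (τ : W →+ W), (∀ u v, β (σ u) v = τ (β u v)) →
      ∃ c : ZMod p, ∀ w, τ w = c • w)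
    {d n : ℕ} (hV : Nat.card V = p ^ d) (hW : Nat.card W = p ^ 2) (hd : d + 2 ≤ n) :
    ∃ G : GenusTwoGroup (p ^ n), @HasCommutationMap (Fin (p ^ n)) G.1 _ _ _ _ fun u v => β u v := by
  -- A central factor that meets the commutator subgroup trivially; it pads the order to p^n and
  -- leaves the commutation map alone.
  let C := ZMod (p ^ (n - d - 2))
  have hcard : Nat.card (CentralExt b C) = p ^ n := by
    rw [Nat.card_congr CentralExt.equivProd, Nat.card_prod, Nat.card_prod, hV, hW, Nat.card_zmod,
      ← pow_add, ← pow_add]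
    congr 1
    omega
  have hfin : Finite (CentralExt b C) := Nat.finite_of_card_ne_zero (by
    rw [hcard]; exact pow_ne_zero _ hp.out.ne_zero)
  have h0 : CommutatorsGivenBy (CentralExt b C) fun u v => β u v := by
    simpa only [hb] using CentralExt.commutatorsGivenBy b C
  -- An abstract carrier keeps the arithmetic of `Fin` apart from the transported group law.
  have key : ∀ (H : Type) (_ : H ≃ CentralExt b C), ∃ g : Group H, HasGenusOverField H 2 ∧
      HasCommutationMap H fun u v => β u v := fun H e => by
    let _ : Group H := e.group
    have h1 := (h0.congr e.mulEquiv.symm).hasCommutationMap hn hs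
    exact ⟨e.group, h1.hasGenusOverField hn hW hscal, h1⟩
  obtain ⟨g, hg, hg'⟩ := key (Fin (p ^ n)) (Finite.equivFinOfCardEq hcard).symm
  exact ⟨⟨g, hg⟩, hg'⟩

end GenusTwo


/-! ### The pencils attached to an algebra with a distinguished element -/

section Pencil

variable {p : ℕ} [hp : Fact p.Prime] {R : Type} [CommRing R] [Algebra (ZMod p) R]

/-- The biadditive map `(u, v) ↦ (φ (u₁ v₂), φ (θ u₁ v₂))`. -/
def pencilCocycle (φ : R →ₗ[ZMod p] ZMod p) (θ : R) : R × R →+ R × R →+ ZMod p × ZMod p :=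
  AddMonoidHom.mk' (fun u => AddMonoidHom.mk'
    (fun v => (φ (u.1 * v.2), φ (θ * (u.1 * v.2))))
    fun v v' => by simp [mul_add])
    fun u u' => by ext v <;> simp [add_mul, mul_add]

/-- The alternating biadditive map `(u, v) ↦ (φ (u₁ v₂ - v₁ u₂), φ (θ (u₁ v₂ - v₁ u₂)))`. -/
def pencilForm (φ : R →ₗ[ZMod p] ZMod p) (θ : R) : R × R →+ R × R →+ ZMod p × ZMod p :=
  pencilCocycle φ θ - (pencilCocycle φ θ).flip

theorem pencilForm_apply (φ : R →ₗ[ZMod p] ZMod p) (θ : R) (u v : R × R) :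
    pencilForm φ θ u v =
      (φ (u.1 * v.2 - v.1 * u.2), φ (θ * (u.1 * v.2 - v.1 * u.2))) := by
  simp [pencilForm, pencilCocycle, mul_sub]

/-- The functional `φ` vanishes on no nonzero ideal. -/
def IsNondegenerate (φ : R →ₗ[ZMod p] ZMod p) : Prop :=
  ∀ r, (∀ s, φ (r * s) = 0) → r = 0

theorem IsNondegenerate.eq_of_forall {φ : R →ₗ[ZMod p] ZMod p} (hφ : IsNondegenerate φ) {x y : R}
    (h : ∀ s, φ (x * s) = φ (y * s)) : x = y := by
  rw [← sub_eq_zero]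
  refine hφ _ fun s => ?_
  rw [sub_mul, map_sub, h, sub_self]

theorem IsNondegenerate.eq_zero_of_form {φ : R →ₗ[ZMod p] ZMod p} (hφ : IsNondegenerate φ)
    {u : R × R} (h : ∀ v : R × R, φ (u.1 * v.2 - v.1 * u.2) = 0) : u = 0 := by
  refine Prod.ext (hφ _ fun s => ?_) (hφ _ fun s => ?_)
  · simpa using h (0, s)
  · simpa [mul_comm] using h (s, 0)

theorem addMonoidHom_apply_eq (τ : ZMod p × ZMod p →+ ZMod p × ZMod p) (w : ZMod p × ZMod p) :
    τ w = (w.1 * (τ (1, 0)).1 + w.2 * (τ (0, 1)).1, w.1 * (τ (1, 0)).2 + w.2 * (τ (0, 1)).2) := by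
  have h : w = w.1 • ((1, 0) : ZMod p × ZMod p) + w.2 • ((0, 1) : ZMod p × ZMod p) := by
    ext <;> simp
  conv_lhs => rw [h, map_add, ZMod.map_smul, ZMod.map_smul]
  ext <;> simp

/-- Pairing (1, 0) with (0, s) shows that the first coordinate a of σ(1, 0) and its multiple θa are
both F_p-combinations of 1 and θ. Eliminating a leaves a quadratic relation for θ, whose vanishing
coefficients say that `τ` is scalar. -/
theorem pencilForm_scalars {φ : R →ₗ[ZMod p] ZMod p} (hφ : IsNondegenerate φ) {θ : R}
    (hθ : ∀ a b c : ZMod p, a • (1 : R) + b • θ + c • θ ^ 2 = 0 → a = 0 ∧ b = 0 ∧ c = 0)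
    (σ : R × R →+ R × R) (τ : ZMod p × ZMod p →+ ZMod p × ZMod p)
    (h : ∀ u v, pencilForm φ θ (σ u) v = τ (pencilForm φ θ u v)) :
    ∃ c : ZMod p, ∀ w, τ w = c • w := by
  have h1 : ∀ s, (φ ((σ (1, 0)).1 * s), φ (θ * ((σ (1, 0)).1 * s))) = τ (φ s, φ (θ * s)) :=
    fun s => by simpa [pencilForm_apply] using h (1, 0) (0, s)
  have h2 : (σ (1, 0)).1 = (τ (1, 0)).1 • (1 : R) + (τ (0, 1)).1 • θ :=
    hφ.eq_of_forall fun s => by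
      have := (Prod.ext_iff.mp ((h1 s).trans (addMonoidHom_apply_eq τ _))).1
      simp only at this
      rw [this, add_mul, smul_mul_assoc, smul_mul_assoc, map_add, map_smul, map_smul, one_mul]
      simp [mul_comm]
  have h3 : θ * (σ (1, 0)).1 = (τ (1, 0)).2 • (1 : R) + (τ (0, 1)).2 • θ :=
    hφ.eq_of_forall fun s => by
      have := (Prod.ext_iff.mp ((h1 s).trans (addMonoidHom_apply_eq τ _))).2
      simp only at this
      rw [mul_assoc, this, add_mul, smul_mul_assoc, smul_mul_assoc, map_add, map_smul, map_smul,
        one_mul]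
      simp [mul_comm]
  rw [h2] at h3
  obtain ⟨ha, hb, hc⟩ := hθ (-(τ (1, 0)).2) ((τ (1, 0)).1 - (τ (0, 1)).2) (τ (0, 1)).1 (by
    rw [mul_add, mul_smul_comm, mul_smul_comm, mul_one, ← sub_eq_zero] at h3
    rw [← h3, sub_smul, neg_smul, pow_two]
    abel)
  refine ⟨(τ (1, 0)).1, fun w => ?_⟩
  rw [addMonoidHom_apply_eq τ w, hc, neg_eq_zero.mp ha, ← sub_eq_zero.mp hb]
  ext <;> simp [mul_comm]

/-- `θ'` acts on `R' × R'` as a Möbius transformation of `θ` acts on `R × R`. -/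
def MoebiusRelated (θ : R) {R' : Type} [CommRing R'] [Algebra (ZMod p) R'] (θ' : R')
    (t : (ZMod p × ZMod p) × (ZMod p × ZMod p)) : Prop :=
  ∃ Φ : R × R ≃+ R' × R',
    (∀ u : R × R, t.1.1 • u + t.1.2 • (θ • u) = 0 → u = 0) ∧
    ∀ u : R × R, t.1.1 • Φ.symm (θ' • Φ u) + t.1.2 • (θ • Φ.symm (θ' • Φ u)) =
      t.2.1 • u + t.2.2 • (θ • u)

/-- `t` is the matrix of `Ψ`. Its rows express both forms of the second pencil as φ(ω(·, v)) with u
replaced by a combination of u and θu. The second form is also the first with u replaced by θ'u;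
comparing the two gives the relation, and nondegeneracy of φ' makes the denominator injective. -/
theorem exists_moebiusRelated {R' : Type} [CommRing R'] [Algebra (ZMod p) R']
    {φ : R →ₗ[ZMod p] ZMod p} (hφ : IsNondegenerate φ) {θ : R}
    {φ' : R' →ₗ[ZMod p] ZMod p} (hφ' : IsNondegenerate φ') {θ' : R'}
    (Φ : R × R ≃+ R' × R') (Ψ : ZMod p × ZMod p ≃+ ZMod p × ZMod p)
    (h : ∀ u v, pencilForm φ' θ' (Φ u) (Φ v) = Ψ (pencilForm φ θ u v)) :
    ∃ t, MoebiusRelated (p := p) θ θ' t := by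
  let ω (u v : R × R) : R := u.1 * v.2 - v.1 * u.2
  let ω' (u v : R' × R') : R' := u.1 * v.2 - v.1 * u.2
  have hω (a b : ZMod p) (u v : R × R) :
      φ (ω (a • u + b • (θ • u)) v) = φ (ω u v) * a + φ (θ * ω u v) * b := by
    have : ω (a • u + b • (θ • u)) v = a • ω u v + b • (θ * ω u v) := by
      simp only [ω, Prod.fst_add, Prod.snd_add, Prod.smul_fst, Prod.smul_snd]
      simp only [smul_eq_mul, Algebra.smul_def]
      ring
    rw [this, map_add, map_smul, map_smul, smul_eq_mul, smul_eq_mul, mul_comm a, mul_comm b]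
  let t := (((Ψ (1, 0)).1, (Ψ (0, 1)).1), ((Ψ (1, 0)).2, (Ψ (0, 1)).2))
  have h0 (u v) : (φ' (ω' (Φ u) (Φ v)), φ' (θ' * ω' (Φ u) (Φ v))) =
      (φ (ω (t.1.1 • u + t.1.2 • (θ • u)) v), φ (ω (t.2.1 • u + t.2.2 • (θ • u)) v)) := by
    have := h u v
    rw [pencilForm_apply, pencilForm_apply] at this
    refine this.trans ?_
    rw [hω, hω]
    exact addMonoidHom_apply_eq Ψ.toAddMonoidHom _
  refine ⟨t, Φ, fun u hu => ?_, fun u => ?_⟩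
  · rw [← map_eq_zero_iff Φ Φ.injective]
    refine hφ'.eq_zero_of_form fun v => ?_
    have := (Prod.ext_iff.mp (h0 u (Φ.symm v))).1
    rw [Φ.apply_symm_apply] at this
    refine this.trans ?_
    rw [hu]
    simp [ω]
  · rw [← sub_eq_zero]
    refine hφ.eq_zero_of_form fun v => ?_
    have h1 := (Prod.ext_iff.mp (h0 (Φ.symm (θ' • Φ u)) v)).1
    have h2 := (Prod.ext_iff.mp (h0 u v)).2
    have h3 : ω' (Φ (Φ.symm (θ' • Φ u))) (Φ v) = θ' * ω' (Φ u) (Φ v) := by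
      rw [Φ.apply_symm_apply]
      simp only [ω', Prod.smul_fst, Prod.smul_snd, smul_eq_mul]
      ring
    simp only at h1 h2
    rw [h3, h2] at h1
    have h4 (x y : R × R) : (x - y).1 * v.2 - v.1 * (x - y).2 = ω x v - ω y v := by
      simp only [ω, Prod.fst_sub, Prod.snd_sub]
      ring
    rw [h4, map_sub, h1, sub_self]

/-- The denominator is injective, so `θ` and `t` determine the transported operator. Two elements
related to `θ` by the same `t` thus act by conjugate operators. -/
theorem MoebiusRelated.exists_intertwiner {R' R'' : Type} [CommRing R'] [Algebra (ZMod p) R']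
    [CommRing R''] [Algebra (ZMod p) R''] {θ : R} {θ' : R'} {θ'' : R''}
    {t : (ZMod p × ZMod p) × (ZMod p × ZMod p)} (h' : MoebiusRelated θ θ' t)
    (h'' : MoebiusRelated θ θ'' t) :
    ∃ Ξ : R' × R' ≃+ R'' × R'', ∀ u, Ξ (θ' • u) = θ'' • Ξ u := by
  obtain ⟨Φ', hi, h1⟩ := h'
  obtain ⟨Φ'', -, h2⟩ := h''
  refine ⟨Φ'.symm.trans Φ'', fun u => ?_⟩
  have h3 : Φ'.symm (θ' • Φ' (Φ'.symm u)) = Φ''.symm (θ'' • Φ'' (Φ'.symm u)) := by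
    rw [← sub_eq_zero]
    refine hi _ ?_
    have := sub_eq_zero.mpr ((h1 (Φ'.symm u)).trans (h2 (Φ'.symm u)).symm)
    rw [← this]
    simp only [smul_sub]
    abel
  rw [Φ'.apply_symm_apply, AddEquiv.eq_symm_apply] at h3
  exact h3

/-- Additive maps between spaces over F_p are linear, so `Ξ` intertwines every polynomial in `θ` and
`θ'`; evaluate at the preimage of (1, 0). -/
theorem aeval_eq_zero_of_intertwiner {R' : Type} [CommRing R'] [Algebra (ZMod p) R'] {θ : R}
    {θ' : R'} (Ξ : R × R ≃+ R' × R') (h : ∀ u, Ξ (θ • u) = θ' • Ξ u) {g : (ZMod p)[X]}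
    (hg : aeval θ g = 0) : aeval θ' g = 0 := by
  have hpow : ∀ (n : ℕ) (u), Ξ (θ ^ n • u) = θ' ^ n • Ξ u := fun n => by
    induction n with
    | zero => simp
    | succ n ih =>
      intro u
      rw [pow_succ, pow_succ, mul_smul, mul_smul, ih, h]
  have key : ∀ (g : (ZMod p)[X]) (u), Ξ (aeval θ g • u) = aeval θ' g • Ξ u := fun g => by
    induction g using Polynomial.induction_on' with
    | add f g hf hg =>
      intro u
      rw [map_add, map_add, add_smul, add_smul, map_add, hf, hg]
    | monomial n a =>
      intro u
      rw [aeval_monomial, aeval_monomial, mul_smul, mul_smul, algebraMap_smul, algebraMap_smul,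
        ZMod.map_smul, hpow]
  have h1 := key g (Ξ.symm (1, 0))
  rw [hg, zero_smul, map_zero, Ξ.apply_symm_apply] at h1
  simpa using (congrArg Prod.fst h1).symm

end Pencil


/-! ### Lower bound: counting pencils of monic polynomials -/

section Counting

variable {p : ℕ} [hp : Fact p.Prime]

theorem AdjoinRoot.exists_functional {f : (ZMod p)[X]} (hf : f.Monic) (hd : 2 ≤ f.natDegree) :
    ∃ φ : AdjoinRoot f →ₗ[ZMod p] ZMod p, IsNondegenerate φ ∧
      ∀ w : ZMod p × ZMod p, ∃ r, (φ r, φ (root f * r)) = w := by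
  let φ := (lcoeff (ZMod p) (f.natDegree - 1)).comp (modByMonicHom hf)
  have hφ : ∀ g, φ (mk f g) = topCoeff f g := fun g => rfl
  refine ⟨φ, fun r hr => ?_, fun w => ?_⟩
  · obtain ⟨g, rfl⟩ := mk_surjective r
    rw [mk_eq_zero]
    refine dvd_of_topCoeff hf fun j => ?_
    rw [← hφ, map_mul, hr]
  · have hlow : ∀ g : (ZMod p)[X], g.natDegree < f.natDegree →
        topCoeff f g = g.coeff (f.natDegree - 1) := fun g hg => by
      rw [topCoeff_apply, (modByMonic_eq_self_iff hf).mpr (degree_lt_degree hg)]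
    have h1 : topCoeff f (X ^ (f.natDegree - 1)) = 1 := by
      rw [hlow _ (by rw [natDegree_X_pow]; omega), coeff_X_pow, if_pos rfl]
    have h2 : topCoeff f (X ^ (f.natDegree - 2)) = 0 := by
      rw [hlow _ (by rw [natDegree_X_pow]; omega), coeff_X_pow, if_neg (by omega)]
    have h3 : (X : (ZMod p)[X]) * X ^ (f.natDegree - 2) = X ^ (f.natDegree - 1) := by
      rw [← pow_succ']
      congr 1
      omega
    -- The functional is 1 on X^(m-1) and 0 on X^(m-2), while multiplication by X takes the latter
    -- to the former; the system for the two coefficients is triangular.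
    refine ⟨mk f (w.1 • X ^ (f.natDegree - 1) +
      (w.2 - w.1 * topCoeff f (X * X ^ (f.natDegree - 1))) • X ^ (f.natDegree - 2)), ?_⟩
    rw [← mk_X, ← map_mul, hφ, hφ, mul_add, mul_smul_comm, mul_smul_comm, h3]
    simp [h1, h2]

theorem AdjoinRoot.eq_zero_of_quadratic {f : (ZMod p)[X]} (hd : 3 ≤ f.natDegree)
    (a b c : ZMod p) (h : a • (1 : AdjoinRoot f) + b • root f + c • root f ^ 2 = 0) :
    a = 0 ∧ b = 0 ∧ c = 0 := by
  have h1 : mk f (C c * X ^ 2 + C b * X + C a) = 0 := by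
    rw [← h, ← aeval_eq]
    simp [Algebra.smul_def]
    ring
  rw [mk_eq_zero] at h1
  have h2 := eq_zero_of_dvd_of_natDegree_lt h1
    (natDegree_quadratic_le.trans_lt (by omega))
  refine ⟨?_, ?_, ?_⟩
  · simpa using congrArg (coeff · 0) h2
  · simpa [coeff_X, coeff_C] using congrArg (coeff · 1) h2
  · simpa [coeff_X, coeff_C] using congrArg (coeff · 2) h2

theorem AdjoinRoot.natCard_zmod {f : (ZMod p)[X]} (hf : f.Monic) :
    Nat.card (AdjoinRoot f) = p ^ f.natDegree := by
  have := hf.finite_adjoinRoot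
  have := hf.free_adjoinRoot
  rw [Module.natCard_eq_pow_finrank (K := ZMod p), Nat.card_zmod,
    (powerBasis' hf).finrank, powerBasis'_dim]

theorem natCard_zmod_prod {p : ℕ} : Nat.card (ZMod p × ZMod p) = p ^ 2 := by
  rw [Nat.card_prod, Nat.card_zmod, pow_two]

/-- `G` has the commutation map of the pencil attached to `AdjoinRoot f`. -/
def IsPencilGroup (G : Type) [Group G] (f : (ZMod p)[X]) : Prop :=
  ∃ φ : AdjoinRoot f →ₗ[ZMod p] ZMod p, IsNondegenerate φ ∧
    HasCommutationMap G fun u v => pencilForm φ (AdjoinRoot.root f) u v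

theorem exists_isPencilGroup {f : (ZMod p)[X]} (hf : f.Monic) (hd : 3 ≤ f.natDegree) {n : ℕ}
    (hn : 2 * f.natDegree + 2 ≤ n) :
    ∃ G : GenusTwoGroup (p ^ n), @IsPencilGroup p _ (Fin (p ^ n)) G.1 f := by
  obtain ⟨φ, hφ, hs⟩ := AdjoinRoot.exists_functional hf (by omega)
  obtain ⟨G, hG⟩ := exists_genusTwoGroup (p := p) (d := 2 * f.natDegree)
    (pencilCocycle φ (AdjoinRoot.root f)) (pencilForm φ (AdjoinRoot.root f)) (fun _ _ => rfl)
    (fun u hu => hφ.eq_zero_of_form fun v => by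
      have := hu v
      rw [pencilForm_apply] at this
      exact congrArg Prod.fst this)
    (fun w => by
      obtain ⟨r, hr⟩ := hs w
      refine ⟨(1, 0), (0, r), ?_⟩
      rw [pencilForm_apply, ← hr]
      simp)
    (pencilForm_scalars hφ (AdjoinRoot.eq_zero_of_quadratic hd))
    (by rw [Nat.card_prod, AdjoinRoot.natCard_zmod hf, two_mul, pow_add])
    natCard_zmod_prod hn
  exact ⟨G, φ, hφ, hG⟩

/-- The alternating map `(x, s), (x', s') ↦ s' x - s x'`. -/
theorem nonempty_genusTwoGroup {n : ℕ} (hn : 5 ≤ n) : Nonempty (GenusTwoGroup (p ^ n)) := by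
  obtain ⟨b, hb⟩ : ∃ b : (ZMod p × ZMod p) × ZMod p →+ (ZMod p × ZMod p) × ZMod p →+
      ZMod p × ZMod p, ∀ u v, b u v = v.2 • u.1 :=
    ⟨AddMonoidHom.mk' (fun u => AddMonoidHom.mk' (fun v => v.2 • u.1)
      fun v v' => add_smul _ _ _) fun u u' => by ext v <;> simp, fun _ _ => rfl⟩
  obtain ⟨β, hβ⟩ : ∃ β : (ZMod p × ZMod p) × ZMod p →+ (ZMod p × ZMod p) × ZMod p →+
      ZMod p × ZMod p, ∀ u v, β u v = b u v - b v u := ⟨b - b.flip, fun _ _ => rfl⟩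
  obtain ⟨G, -⟩ := exists_genusTwoGroup (p := p) (d := 3) b β hβ
    (fun u hu => by
      have h1 : u.1 = 0 := by simpa [hβ, hb] using hu (0, 1)
      have h2 := hu ((1, 0), 0)
      simp only [hβ, hb, h1, smul_zero, zero_sub, neg_eq_zero] at h2
      exact Prod.ext h1 (by simpa using congrArg Prod.fst h2))
    (fun w => ⟨(w, 0), (0, 1), by simp [hβ, hb]⟩)
    -- The arguments (0, 1) and (-w, 0) have value w, so `τ` must be multiplication by the last
    -- coordinate of σ(0, 1).
    (fun σ τ h => by
      refine ⟨(σ (0, 1)).2, fun w => ?_⟩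
      have h1 := h (0, 1) (-w, 0)
      simpa [hβ, hb] using h1.symm)
    (by rw [Nat.card_prod, natCard_zmod_prod, Nat.card_zmod, ← pow_succ]) natCard_zmod_prod hn
  exact ⟨G⟩

/-- A lower bound on `Nat.card` needs this, since infinite types have `Nat.card` zero. -/
instance finite_genusTwoGroup (N : ℕ) : Finite (GenusTwoGroup N) := by
  have : Finite (Group (Fin N)) :=
    Finite.of_injective (fun G : Group (Fin N) => G.mul) fun G H h => Group.ext (by
      ext x y
      exact congrArg Fin.val (congrFun (congrFun h x) y))
  exact inferInstanceAs (Finite {G : Group (Fin N) // @HasGenusOverField (Fin N) G 2})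

theorem IsPencilGroup.exists_moebiusRelated {G H : Type} [Group G] [Group H] {f g : (ZMod p)[X]}
    (hG : IsPencilGroup G f) (hH : IsPencilGroup H g) (h : Isoclinic G H) :
    ∃ t, MoebiusRelated (p := p) (AdjoinRoot.root f) (AdjoinRoot.root g) t := by
  obtain ⟨φ, hφ, hG⟩ := hG
  obtain ⟨φ', hφ', hH⟩ := hH
  obtain ⟨Φ, Ψ, hΦ⟩ := hG.exists_equiv_of_isoclinic hH h
  exact _root_.exists_moebiusRelated hφ hφ' Φ Ψ hΦ

theorem dvd_of_intertwiner {f g : (ZMod p)[X]}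
    (Ξ : AdjoinRoot f × AdjoinRoot f ≃+ AdjoinRoot g × AdjoinRoot g)
    (h : ∀ u, Ξ (AdjoinRoot.root f • u) = AdjoinRoot.root g • Ξ u) : g ∣ f := by
  have h1 := aeval_eq_zero_of_intertwiner (g := f) Ξ h
    (by rw [AdjoinRoot.aeval_eq, AdjoinRoot.mk_self])
  rwa [AdjoinRoot.aeval_eq, AdjoinRoot.mk_eq_zero] at h1

/-- Conjugate operators have the same annihilating polynomials, so `f` and `g` divide each other. -/
theorem eq_of_moebiusRelated {R : Type} [CommRing R] [Algebra (ZMod p) R] {θ : R}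
    {f g : (ZMod p)[X]} (hf : f.Monic) (hg : g.Monic)
    {t : (ZMod p × ZMod p) × (ZMod p × ZMod p)}
    (h₁ : MoebiusRelated θ (AdjoinRoot.root f) t) (h₂ : MoebiusRelated θ (AdjoinRoot.root g) t) :
    f = g := by
  obtain ⟨Ξ, hΞ⟩ := h₁.exists_intertwiner h₂
  obtain ⟨Ξ', hΞ'⟩ := h₂.exists_intertwiner h₁
  exact eq_of_monic_of_associated hf hg
    (associated_of_dvd_dvd (dvd_of_intertwiner Ξ' hΞ') (dvd_of_intertwiner Ξ hΞ))

/-- Fix one polynomial in each fibre of the map to isoclinism classes. Every other in the fibre is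
determined by a 2 × 2 matrix over F_p relating it to the fixed one, so fibres have at most p^4
elements. -/
theorem pow_le_mul_numGenusTwo {m n : ℕ} (hm : 3 ≤ m) (hn : 2 * m + 2 ≤ n) :
    p ^ m ≤ p ^ 4 * numGenusTwo (p ^ n) := by
  classical
  have hne : Nonempty (GenusTwoGroup (p ^ n)) := nonempty_genusTwoGroup (by omega)
  have hex : ∀ f : (ZMod p)[X], f.Monic ∧ f.natDegree = m →
      ∃ G : GenusTwoGroup (p ^ n), @IsPencilGroup p _ (Fin (p ^ n)) G.1 f := by
    rintro f ⟨hf, rfl⟩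
    exact exists_isPencilGroup hf hm hn
  choose! Γ hΓ using hex
  let q : (ZMod p)[X] → Quotient (isoclinismSetoid (p ^ n)) := fun f => Quotient.mk _ (Γ f)
  have hfibre : ∀ c ∈ (monics (ZMod p) m).image q,
      ((monics (ZMod p) m).filter fun f => q f = c).card ≤ p ^ 4 := by
    intro c hc
    obtain ⟨f, hf, rfl⟩ := Finset.mem_image.mp hc
    rw [mem_monics] at hf
    have hrel : ∀ g ∈ (monics (ZMod p) m).filter fun g => q g = q f,
        ∃ t, MoebiusRelated (p := p) (AdjoinRoot.root f) (AdjoinRoot.root g) t := by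
      intro g hg
      rw [Finset.mem_filter, mem_monics] at hg
      have h1 := Quotient.exact hg.2.symm
      exact @IsPencilGroup.exists_moebiusRelated p _ (Fin (p ^ n)) (Fin (p ^ n)) (Γ f).1 (Γ g).1
        f g (hΓ f hf) (hΓ g hg.1) h1
    choose! t ht using hrel
    have hcard : (Finset.univ : Finset ((ZMod p × ZMod p) × (ZMod p × ZMod p))).card = p ^ 4 := by
      rw [Finset.card_univ, ← Nat.card_eq_fintype_card, Nat.card_prod, natCard_zmod_prod,
        ← pow_add]
    rw [← hcard]
    refine Finset.card_le_card_of_injOn t (fun _ _ => Finset.mem_univ _) fun g hg g' hg' h => ?_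
    have h1 := ht g hg
    rw [h] at h1
    have hg1 := (mem_monics.mp (Finset.mem_filter.mp hg).1).1
    have hg2 := (mem_monics.mp (Finset.mem_filter.mp hg').1).1
    exact eq_of_moebiusRelated hg1 hg2 h1 (ht g' hg')
  calc p ^ m = (monics (ZMod p) m).card := by rw [card_monics, Nat.card_zmod]
    _ ≤ p ^ 4 * ((monics (ZMod p) m).image q).card := Finset.card_le_mul_card_image _ _ hfibre
    _ ≤ p ^ 4 * numGenusTwo (p ^ n) := by
      gcongr
      have := Fintype.ofFinite (Quotient (isoclinismSetoid (p ^ n)))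
      rw [numGenusTwo, Nat.card_eq_fintype_card]
      exact Finset.card_le_univ _

/-- For m = ⌊(n - 2)/2⌋ ≥ (n - 3)/2 the exponent m - 4 is at least n/2 - 11/2, and n ≥ 8 ensures m ≥
3. For 5 ≤ n ≤ 7 the exponent on the left is negative, and the existence of one group is enough. -/
theorem le_numGenusTwo {n : ℕ} (hn : 5 ≤ n) :
    (p : ℝ) ^ ((n : ℝ) / 2 + (-11 / 2)) ≤ (numGenusTwo (p ^ n) : ℝ) := by
  have hp1 : (1 : ℝ) ≤ p := by exact_mod_cast hp.out.one_le
  have hp0 : (0 : ℝ) < p := by linarith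
  rcases le_or_gt n 7 with h7 | h7
  · have hne : Nonempty (GenusTwoGroup (p ^ n)) := nonempty_genusTwoGroup hn
    have h1 : (1 : ℝ) ≤ numGenusTwo (p ^ n) := by
      have : Nonempty (Quotient (isoclinismSetoid (p ^ n))) := hne.map (Quotient.mk _)
      exact_mod_cast Nat.card_pos (α := Quotient (isoclinismSetoid (p ^ n)))
    refine le_trans (Real.rpow_le_one_of_one_le_of_nonpos hp1 ?_) h1
    have : (n : ℝ) ≤ 7 := by exact_mod_cast h7
    linarith
  · obtain ⟨m, hm⟩ : ∃ m, m = (n - 2) / 2 := ⟨_, rfl⟩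
    have h1 := pow_le_mul_numGenusTwo (p := p) (m := m) (n := n) (by omega) (by omega)
    have h2 : (p : ℝ) ^ m ≤ p ^ 4 * numGenusTwo (p ^ n) := by exact_mod_cast h1
    have h3 : (p : ℝ) ^ ((n : ℝ) / 2 + (-11 / 2)) * p ^ 4 ≤ (p : ℝ) ^ m := by
      rw [← Real.rpow_natCast _ 4, ← Real.rpow_natCast _ m, ← Real.rpow_add hp0]
      refine Real.rpow_le_rpow_of_exponent_le hp1 ?_
      have : (n : ℝ) ≤ 2 * m + 3 := by exact_mod_cast (by omega : n ≤ 2 * m + 3)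
      push_cast
      linarith
    have h4 : (0 : ℝ) < p ^ 4 := by positivity
    nlinarith

end Counting

theorem proposition9p1 :
    ∃ a b : ℝ, ∀ p : ℕ, p.Prime → ∀ n : ℕ, 5 ≤ n →
      (p : ℝ) ^ ((n : ℝ) / 2 + a) ≤ (numGenusTwo (p ^ n) : ℝ) ∧
        (numGenusTwo (p ^ n) : ℝ) ≤ (p : ℝ) ^ ((n : ℝ) / 2 + b) := by
  obtain ⟨b, hb⟩ := exists_numGenusTwo_le
  refine ⟨-11 / 2, b, fun p hp n hn => ⟨?_, hb p hp n⟩⟩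
  have : Fact p.Prime := ⟨hp⟩
  exact le_numGenusTwo hn
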